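/- Let $R>0$, $M\ge 0$, $\beta>0$, and let $D:[R,\infty)\to(0,\infty)$ be smooth with $D(r)=1-\frac{2M}{r}+O_3(r^{-1-\beta})$, i.e. for each $0\le j\le 3$ there is $C_j>0$ such that $\left|\frac{d^j}{dr^j}\left(D-1+\frac{2M}{r}\right)\right|\le C_j r^{-1-\beta-j}$ on $[R,\infty)$. Consider the region $\mathcal{A}=\{u\ge 0,\ r\ge R\}=[0,\infty)\times[R,\infty)\times\mathbb{S}^2$ with the Lorentzian metric $$g=-D(r)\,du^2-2\,du\,dr+r^2(d\theta^2+\sin^2\theta\,d\varphi^2).$$ Let $\psi:\mathcal{A}\to\mathbb{R}$ be smooth (up to the boundary) with $\square_g\psi=0$, let $\psi_0(u,r)=\frac1{4\pi}\int_{\mathbb{S}^2}\psi(u,r,\omega)\,d\omega$ be its spherical mean, and suppose that the first Newman--Penrose constant $$I_0[\psi]=\lim_{r\to\infty}r^2\,\partial_r(r\psi_0)(0,r)$$ exists in $\mathbb{R}$ and is non-zero. Then the range $p<3$ in the hierarchy of $r^p$-weighted estimates (which bound $\int r^{p-1}(\partial_r(r\psi_0))^2\,dr\,du$) is sharp, in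 the sense that for every $0\le u_0<\infty$ $$\int_{u_0}^{\infty}\int_R^{\infty} r^2\,\bigl(\partial_r(r\psi_0)\bigr)^2\,dr\,du=\infty .$$ -/

import Mathlib

open Set Filter Topology MeasureTheory
open scoped ContDiff

noncomputable section

namespace BondiWave

/-- `f = O_k(r^{-l})` on `[R, ∞)`: every derivative of order `j ≤ k` is bounded by a constant
times `r^{-l-j}`. -/
def IsBigOWithDerivs (R : ℝ) (k : ℕ) (l : ℝ) (f : ℝ → ℝ) : Prop :=
  ∀ j : ℕ, j ≤ k → ∃ C : ℝ, 0 < C ∧ ∀ r : ℝ, R ≤ r →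
    |iteratedDerivWithin j f (Ici R) r| ≤ C * r ^ (-l - (j : ℝ))

/-- Assumptions on the metric coefficient `D` on the far-away region `r ≥ R`:
`D` is smooth, positive (the Killing field `∂_u` is timelike) and
`D(r) = 1 - 2M/r + O_3(r^{-1-β})`. Nothing is said about the values of `D` on `r < R`. -/
structure IsAsymptoticallyFlat (R M β : ℝ) (D : ℝ → ℝ) : Prop where
  R_pos : 0 < R
  M_nonneg : 0 ≤ M
  β_pos : 0 < β
  smooth : ContDiffOn ℝ ∞ D (Ici R)
  pos : ∀ r : ℝ, R ≤ r → 0 < D r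
  asymptotics : IsBigOWithDerivs R 3 (1 + β) (fun r => D r - (1 - 2 * M / r))

/-- The `i`-th coordinate partial derivative of a function of four real variables. -/
def pderiv (i : Fin 4) (f : (Fin 4 → ℝ) → ℝ) (x : Fin 4 → ℝ) : ℝ :=
  deriv (fun t : ℝ => f (Function.update x i t)) (x i)

/-- The wave operator (Laplace-Beltrami operator) of a Lorentzian metric with component matrix `g`
in a coordinate chart:
`□_g f = |det g|^{-1/2} ∂_α (|det g|^{1/2} (g⁻¹)^{αβ} ∂_β f)`. -/
def waveOp (g : (Fin 4 → ℝ) → Matrix (Fin 4) (Fin 4) ℝ) (f : (Fin 4 → ℝ) → ℝ)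
    (x : Fin 4 → ℝ) : ℝ :=
  (√|(g x).det|)⁻¹ *
    ∑ a : Fin 4, pderiv a (fun y => √|(g y).det| * ∑ b : Fin 4, (g y)⁻¹ a b * pderiv b f y) x

/-- The metric `-D(r) du² - 2 du dr + r² (dθ² + sin² θ dφ²)` in Bondi coordinates
`x = (u, r, θ, φ)`. -/
def bondiMetric (D : ℝ → ℝ) (x : Fin 4 → ℝ) : Matrix (Fin 4) (Fin 4) ℝ :=
  !![-D (x 1), -1, 0, 0;
     -1, 0, 0, 0;
     0, 0, x 1 ^ 2, 0;
     0, 0, 0, x 1 ^ 2 * Real.sin (x 2) ^ 2]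

/-- The point of `ℝ³` with spherical coordinates `(r, θ, φ)`. -/
def sphericalPoint (r θ φ : ℝ) : EuclideanSpace ℝ (Fin 3) :=
  !₂[r * Real.sin θ * Real.cos φ, r * Real.sin θ * Real.sin φ, r * Real.cos θ]

/-- The region `𝒜 = {u ≥ 0, r ≥ R}`. The factor `[R, ∞) × 𝕊²` of `𝒜 = [0, ∞) × [R, ∞) × 𝕊²` is
identified with `{x ∈ ℝ³ : |x| ≥ R}` through `(r, ω) ↦ r ω`. -/
def farRegion (R : ℝ) : Set (ℝ × EuclideanSpace ℝ (Fin 3)) :=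
  {p | 0 ≤ p.1 ∧ R ≤ ‖p.2‖}

/-- The expression of a function on the far region in the coordinates `(u, r, θ, φ)`. -/
def inBondi (ψ : ℝ × EuclideanSpace ℝ (Fin 3) → ℝ) (x : Fin 4 → ℝ) : ℝ :=
  ψ (x 0, sphericalPoint (x 1) (x 2) (x 3))

/-- `ψ` is smooth on the far region, up to and including its boundary, and solves `□_g ψ = 0`.
The equation is imposed at the interior points covered by the Bondi chart; since `ψ` is smooth, it
then holds on the whole region. -/
structure IsLinearWave (D : ℝ → ℝ) (R : ℝ) (ψ : ℝ × EuclideanSpace ℝ (Fin 3) → ℝ) : Prop where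
  smooth : ContDiffOn ℝ ∞ ψ (farRegion R)
  wave_eq : ∀ u r θ φ : ℝ, 0 < u → R < r → θ ∈ Ioo 0 Real.pi → φ ∈ Ioo 0 (2 * Real.pi) →
    waveOp (bondiMetric D) (inBondi ψ) ![u, r, θ, φ] = 0

/-- The spherical mean `ψ₀(u, r) = (1/4π) ∫_{𝕊²} ψ(u, r, ω) dω`. -/
def sphericalMean (ψ : ℝ × EuclideanSpace ℝ (Fin 3) → ℝ) (u r : ℝ) : ℝ :=
  (4 * Real.pi)⁻¹ *
    ∫ θ in (0 : ℝ)..Real.pi, ∫ φ in (0 : ℝ)..(2 * Real.pi),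
      ψ (u, sphericalPoint r θ φ) * Real.sin θ

/-- The derivative `∂_r (r ψ₀)(u, r)` of the radiation field of the spherical mean, at fixed `u`. -/
def drRadiationField (ψ : ℝ × EuclideanSpace ℝ (Fin 3) → ℝ) (u r : ℝ) : ℝ :=
  deriv (fun s : ℝ => s * sphericalMean ψ u s) r

/-- The first Newman-Penrose constant of `ψ` exists and equals `I`: along the initial null
hypersurface `u = 0`, `r² ∂_r (r ψ₀) → I` as `r → ∞`. -/
def HasNewmanPenroseConstant (ψ : ℝ × EuclideanSpace ℝ (Fin 3) → ℝ) (I : ℝ) : Prop :=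
  Tendsto (fun r : ℝ => r ^ 2 * drRadiationField ψ 0 r) atTop (𝓝 I)

end BondiWave

end

noncomputable section

namespace BondiWave

/-! ### Interval integrals depending on a parameter, and `r²`-weighted inequalities. -/

section Calculus

/-! Averaging over spheres kills the angular Laplacian, so `φ = r ψ₀` and `Φ = ∂_r φ` satisfy `2 ∂_u
Φ = ∂_r (D Φ) - (D' / r) φ` (`IsLinearWave.isSphericalWave`). Suppose `r² Φ²` were integrable on `u
≥ u₀`, `r ≥ a`, for some `a > R`. An energy estimate with finite speed of propagation
(`IsSphericalWave.exists_integral_le`) bounds its integral over the strip `0 ≤ u ≤ u₀`, so it is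
integrable on all of `u ≥ 0`, `r ≥ a`.

Now test the equation on `[0, L] × [L, 2L]` with `(L - u) h(r)`, `h = (r - L)(2L - r)`. The weight
`L - u` vanishes at `u = L` and `h` at both ends in `r`, so the only boundary term is the pairing
with the data at `u = 0`. Since `Φ(0, r) ~ I / r²`, it has size `|I| L²`. The terms containing `Φ`
are `L²` times `∫∫ |Φ|` over the rectangle. By Young's inequality this integral is at most `δ⁻¹ ε(L)
+ δ`, where `ε(L) → 0` is the tail of the convergent integral.

The zeroth order term is subtler, because `φ` need not be small. Split `φ(u, r) = φ(u, a) + ∫_a^r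
Φ`. The second piece is again controlled by Young's inequality, up to `O(L) + O(δ L²)`. The first
contributes a bounded factor times `∫ (L - u) φ(u, a) du`. Either `D' = 0` for `r > a`, and that
factor vanishes, or a second pairing, with a fixed bump near a point where `D' ≠ 0`, shows that this
integral is itself `O(L) + O(δ L²)` (`IsSphericalWave.exists_abs_integral_boundary_le`). Dividing by
`L²`, then letting `L → ∞` and `δ → 0`, forces `I = 0` (`IsSphericalWave.newmanPenrose_eq_zero`). -/

theorem continuousOn_intervalIntegral_param {X : Type*} [TopologicalSpace X]
    [FirstCountableTopology X] {f : X → ℝ → ℝ} {s : Set X} {c d : ℝ} (hcd : c ≤ d)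
    (hf : ContinuousOn (Function.uncurry f) (s ×ˢ Icc c d)) :
    ContinuousOn (fun x => ∫ y in c..d, f x y) s := by
  rw [continuousOn_iff_continuous_domRestrict]
  -- Projecting `y` onto `[c, d]` extends the integrand continuously to all `y` without changing the
  -- integral.
  have hg : Continuous (Function.uncurry fun (x : s) (y : ℝ) => f x (projIcc c d hcd y)) := by
    have : (Function.uncurry fun (x : s) (y : ℝ) => f x (projIcc c d hcd y)) =
        Function.uncurry f ∘ fun p : s × ℝ => ((p.1 : X), (projIcc c d hcd p.2 : ℝ)) := by
      ext ⟨x, y⟩; rfl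
    rw [this]
    refine hf.comp_continuous (by fun_prop) ?_
    rintro ⟨x, y⟩
    exact ⟨x.2, (projIcc c d hcd y).2⟩
  have := intervalIntegral.continuous_parametric_intervalIntegral_of_continuous'
    (μ := volume) hg c d
  convert this using 1
  ext x
  refine intervalIntegral.integral_congr fun y hy => ?_
  rw [uIcc_of_le hcd] at hy
  simp [projIcc_of_mem hcd hy]

theorem continuousOn_slice_right {X : Type*} [TopologicalSpace X] {f : X → ℝ → ℝ} {s : Set X}
    {t : Set ℝ} (hf : ContinuousOn (Function.uncurry f) (s ×ˢ t)) {x : X} (hx : x ∈ s) :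
    ContinuousOn (f x) t :=
  hf.comp (f := fun y => (x, y)) (by fun_prop) fun _ hy => ⟨hx, hy⟩

theorem hasDerivAt_intervalIntegral_param {f f' : ℝ → ℝ → ℝ} {U : Set ℝ} {c d x₀ : ℝ}
    (hcd : c ≤ d) (hU : U ∈ 𝓝 x₀)
    (hf : ∀ x ∈ U, ContinuousOn (f x) (Icc c d))
    (hf' : ContinuousOn (Function.uncurry f') (U ×ˢ Icc c d))
    (hd : ∀ x ∈ U, ∀ y ∈ Icc c d, HasDerivAt (fun x => f x y) (f' x y) x) :
    HasDerivAt (fun x => ∫ y in c..d, f x y) (∫ y in c..d, f' x₀ y) x₀ := by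
  obtain ⟨ε, hε, hεU⟩ := Metric.nhds_basis_closedBall.mem_iff.1 hU
  have hK : IsCompact (Metric.closedBall x₀ ε ×ˢ Icc c d) :=
    (isCompact_closedBall x₀ ε).prod isCompact_Icc
  obtain ⟨B, hB⟩ := hK.exists_bound_of_continuousOn
    (hf'.mono (prod_mono hεU subset_rfl))
  have hsub : uIoc c d ⊆ Icc c d := by
    rw [uIoc_of_le hcd]; exact Ioc_subset_Icc_self
  have hmeas : ∀ g : ℝ → ℝ, ContinuousOn g (Icc c d) →
      AEStronglyMeasurable g (volume.restrict (uIoc c d)) := fun g hg =>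
    (hg.mono hsub).aestronglyMeasurable measurableSet_uIoc
  refine (intervalIntegral.hasDerivAt_integral_of_dominated_loc_of_deriv_le
    (bound := fun _ => B) (Metric.closedBall_mem_nhds x₀ hε) ?_ ?_ ?_ ?_ ?_ ?_).2
  · filter_upwards [hU] with x hx using hmeas _ (hf x hx)
  · exact ContinuousOn.intervalIntegrable (by rw [uIcc_of_le hcd]; exact hf _ (mem_of_mem_nhds hU))
  · exact hmeas _ (continuousOn_slice_right hf' (mem_of_mem_nhds hU))
  · exact Eventually.of_forall fun y hy x hx => hB (x, y) ⟨hx, hsub hy⟩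
  · exact intervalIntegrable_const
  · exact Eventually.of_forall fun y hy x hx => hd x (hεU hx) y (hsub hy)

theorem integral_inv_sq {a b : ℝ} (ha : 0 < a) (hab : a ≤ b) :
    ∫ r in a..b, (r ^ 2)⁻¹ = a⁻¹ - b⁻¹ := by
  have : ∀ r ∈ uIcc a b, HasDerivAt (fun r : ℝ => -r⁻¹) ((r ^ 2)⁻¹) r := by
    intro r hr
    rw [uIcc_of_le hab] at hr
    exact (hasDerivAt_inv (by linarith [hr.1] : r ≠ 0)).neg.congr_deriv (neg_neg _)
  rw [intervalIntegral.integral_eq_sub_of_hasDerivAt this]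
  · ring
  · refine ContinuousOn.intervalIntegrable ?_
    rw [uIcc_of_le hab]
    refine ContinuousOn.inv₀ (by fun_prop) fun r hr => ?_
    have : 0 < r := by linarith [hr.1]
    positivity

theorem continuousOn_inv_sq {a b : ℝ} (ha : 0 < a) :
    ContinuousOn (fun r : ℝ => (r ^ 2)⁻¹) (Icc a b) := by
  refine ContinuousOn.inv₀ (by fun_prop) fun r hr => ?_
  have : 0 < r := by linarith [hr.1]
  positivity

/-- Young's inequality for the pairing of `f` with `1`, with weight `r²`. -/
theorem integral_abs_le_young {f : ℝ → ℝ} {a b δ : ℝ} (ha : 0 < a) (hab : a ≤ b) (hδ : 0 < δ)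
    (hf : ContinuousOn f (Icc a b)) :
    ∫ r in a..b, |f r| ≤ δ⁻¹ * (∫ r in a..b, r ^ 2 * f r ^ 2) + δ * (a⁻¹ - b⁻¹) := by
  have hJ := integral_inv_sq ha hab
  have hinv := continuousOn_inv_sq (b := b) ha
  have hi1 : IntervalIntegrable (fun r => r ^ 2 * f r ^ 2) volume a b :=
    ContinuousOn.intervalIntegrable (by rw [uIcc_of_le hab]; fun_prop)
  have hi2 : IntervalIntegrable (fun r : ℝ => (r ^ 2)⁻¹) volume a b :=
    ContinuousOn.intervalIntegrable (by rw [uIcc_of_le hab]; fun_prop)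
  rw [← hJ, ← intervalIntegral.integral_const_mul, ← intervalIntegral.integral_const_mul,
    ← intervalIntegral.integral_add (hi1.const_mul _) (hi2.const_mul _)]
  refine intervalIntegral.integral_mono_on hab
    (ContinuousOn.intervalIntegrable (by rw [uIcc_of_le hab]; fun_prop))
    ((hi1.const_mul _).add (hi2.const_mul _)) fun r hr => ?_
  have hr0 : 0 < r := by linarith [hr.1]
  have h1 : 0 ≤ δ⁻¹ * (r * |f r| - δ * r⁻¹) ^ 2 := by positivity
  have h2 : δ⁻¹ * (r * |f r| - δ * r⁻¹) ^ 2 =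
      δ⁻¹ * (r ^ 2 * |f r| ^ 2) - 2 * |f r| + δ * (r ^ 2)⁻¹ := by
    field_simp
    ring
  rw [sq_abs] at h2
  linarith [abs_nonneg (f r)]

/-- Cauchy–Schwarz against the weight `r⁻²`, whose integral is at most `a⁻¹`; obtaining it from the
Young inequality costs the factor 4. -/
theorem sq_integral_le {f : ℝ → ℝ} {a b : ℝ} (ha : 0 < a) (hab : a ≤ b)
    (hf : ContinuousOn f (Icc a b)) :
    (∫ r in a..b, f r) ^ 2 ≤ 4 * a⁻¹ * ∫ r in a..b, r ^ 2 * f r ^ 2 := by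
  set E := ∫ r in a..b, r ^ 2 * f r ^ 2
  have hE : 0 ≤ E := intervalIntegral.integral_nonneg hab fun r _ => by positivity
  set X := |∫ r in a..b, f r|
  have hX0 : 0 ≤ X := abs_nonneg _
  have hX : ∀ δ > 0, X ≤ δ⁻¹ * E + δ * a⁻¹ := fun δ hδ => by
    have h1 := integral_abs_le_young ha hab hδ hf
    have h2 : X ≤ ∫ r in a..b, |f r| := intervalIntegral.abs_integral_le_integral_abs hab
    have : 0 ≤ δ * b⁻¹ := by have := ha.trans_le hab; positivity
    linarith
  rw [← sq_abs]
  change X ^ 2 ≤ _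
  rcases hX0.eq_or_lt with h0 | h0
  · rw [← h0, zero_pow two_ne_zero]; positivity
  -- This `δ` turns `δ a⁻¹` into `X / 2`, which is absorbed on the left.
  · have := hX (a * X / 2) (by positivity)
    have h3 : a * X / 2 * a⁻¹ = X / 2 := by field_simp
    rw [h3] at this
    have h4 : X / 2 ≤ (a * X / 2)⁻¹ * E := by linarith
    have h5 : X / 2 * X ≤ (a * X / 2)⁻¹ * E * X := mul_le_mul_of_nonneg_right h4 hX0
    have h6 : (a * X / 2)⁻¹ * E * X = 2 * a⁻¹ * E := by field_simp
    nlinarith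

end Calculus

/-! ### Partial derivatives up to the initial hypersurface `u = 0`. -/

/-- The part `u ≥ 0`, `r > R` of the domain of the Bondi coordinates. -/
def bondiDomain (R : ℝ) : Set (Fin 4 → ℝ) := {x | 0 ≤ x 0 ∧ R < x 1}

/-- The partial derivative, one-sided at `u = 0`. -/
def dWithin (R : ℝ) (i : Fin 4) (f : (Fin 4 → ℝ) → ℝ) (x : Fin 4 → ℝ) : ℝ :=
  fderivWithin ℝ f (bondiDomain R) x (Pi.single i 1)

theorem isOpen_bondiInterior (R : ℝ) : IsOpen {x : Fin 4 → ℝ | 0 < x 0 ∧ R < x 1} :=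
  (isOpen_lt continuous_const (continuous_apply 0)).inter
    (isOpen_lt continuous_const (continuous_apply 1))

theorem bondiDomain_mem_nhds {R : ℝ} {x : Fin 4 → ℝ} (h0 : 0 < x 0) (h1 : R < x 1) :
    bondiDomain R ∈ 𝓝 x :=
  mem_of_superset ((isOpen_bondiInterior R).mem_nhds ⟨h0, h1⟩) fun _ hy => ⟨hy.1.le, hy.2⟩

theorem uniqueDiffOn_bondiDomain (R : ℝ) : UniqueDiffOn ℝ (bondiDomain R) := by
  refine uniqueDiffOn_convex ?_ ⟨![1, R + 1, 0, 0], ?_⟩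
  · rintro x ⟨hx0, hx1⟩ y ⟨hy0, hy1⟩ a b ha hb hab
    refine ⟨?_, ?_⟩
    · simp only [Pi.add_apply, Pi.smul_apply, smul_eq_mul]; positivity
    · simp only [Pi.add_apply, Pi.smul_apply, smul_eq_mul]
      exact (convex_Ioi R) hx1 hy1 ha hb hab
  · exact mem_interior_iff_mem_nhds.2 (bondiDomain_mem_nhds (by simp) (by simp))

theorem contDiffOn_dWithin {R : ℝ} {f : (Fin 4 → ℝ) → ℝ} (hf : ContDiffOn ℝ ∞ f (bondiDomain R))
    (i : Fin 4) : ContDiffOn ℝ ∞ (dWithin R i f) (bondiDomain R) :=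
  (hf.fderivWithin (uniqueDiffOn_bondiDomain R) (by simp)).clm_apply contDiffOn_const

/-- The domain has a boundary only in the `u` direction, so all other coordinate lines stay inside
it near `x`, even at `u = 0`. Radial derivatives of the initial data are therefore genuine two-sided
derivatives. -/
theorem hasDerivAt_update_dWithin {R : ℝ} {f : (Fin 4 → ℝ) → ℝ}
    (hf : ContDiffOn ℝ ∞ f (bondiDomain R)) {x : Fin 4 → ℝ} (hx : x ∈ bondiDomain R) {i : Fin 4}
    (hi : i = 0 → 0 < x 0) :
    HasDerivAt (fun t => f (Function.update x i t)) (dWithin R i f x) (x i) := by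
  have h1 : HasFDerivWithinAt f (fderivWithin ℝ f (bondiDomain R) x) (bondiDomain R) x :=
    (hf.differentiableOn (by simp) x hx).hasFDerivWithinAt
  have hup : Function.update x i (x i) = x := Function.update_eq_self i x
  have h2 : HasDerivAt (Function.update x i) (Pi.single i 1) (x i) := hasDerivAt_update x i (x i)
  have hmem : ∀ᶠ t in 𝓝 (x i), Function.update x i t ∈ bondiDomain R := by
    have hc : Continuous (Function.update x i) := continuous_const.update i continuous_id
    by_cases h0 : i = 0
    · refine hc.continuousAt.eventually_mem ?_
      rw [hup]
      exact bondiDomain_mem_nhds (hi h0) hx.2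
    · have : ∀ᶠ t in 𝓝 (x i), R < Function.update x i t 1 :=
        (((continuous_apply 1).comp hc).continuousAt (x := x i)).eventually
          (lt_mem_nhds (by simpa using hx.2))
      filter_upwards [this] with t ht
      exact ⟨by rw [Function.update_of_ne (Ne.symm h0)]; exact hx.1, ht⟩
  rw [← hup] at h1
  have := h1.comp_hasDerivWithinAt (f := Function.update x i) (x i) (s := Function.update x i ⁻¹' bondiDomain R)
    h2.hasDerivWithinAt (fun t ht => ht)
  rw [hup] at this
  exact this.hasDerivAt hmem

theorem pderiv_eq_dWithin {R : ℝ} {f : (Fin 4 → ℝ) → ℝ}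
    (hf : ContDiffOn ℝ ∞ f (bondiDomain R)) {x : Fin 4 → ℝ} (h0 : 0 < x 0) (h1 : R < x 1)
    (i : Fin 4) : pderiv i f x = dWithin R i f x :=
  (hasDerivAt_update_dWithin hf ⟨h0.le, h1⟩ fun _ => h0).deriv

theorem dWithin_comm {R : ℝ} {f : (Fin 4 → ℝ) → ℝ}
    (hf : ContDiffOn ℝ ∞ f (bondiDomain R)) {x : Fin 4 → ℝ} (h0 : 0 < x 0) (h1 : R < x 1)
    (i j : Fin 4) : dWithin R i (dWithin R j f) x = dWithin R j (dWithin R i f) x := by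
  have hnhds := bondiDomain_mem_nhds h0 h1
  have h2 : ContDiffAt ℝ 2 f x :=
    (hf.contDiffAt hnhds).of_le (WithTop.coe_le_coe.2 (le_top : (2 : ℕ∞) ≤ ⊤))
  have key : ∀ i j : Fin 4, dWithin R i (dWithin R j f) x =
      fderiv ℝ (fderiv ℝ f) x (Pi.single i 1) (Pi.single j 1) := by
    intro i j
    have hev : dWithin R j f =ᶠ[𝓝 x] fun y => fderiv ℝ f y (Pi.single j 1) := by
      filter_upwards [(isOpen_bondiInterior R).mem_nhds ⟨h0, h1⟩] with y hy
      rw [dWithin, fderivWithin_of_mem_nhds (bondiDomain_mem_nhds hy.1 hy.2)]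
    have hd : DifferentiableAt ℝ (fderiv ℝ f) x :=
      (h2.fderiv_right (m := 1) one_add_one_eq_two.le).differentiableAt (by simp)
    rw [dWithin, fderivWithin_of_mem_nhds hnhds, hev.fderiv_eq,
      fderiv_clm_apply hd (differentiableAt_const _)]
    simp
  rw [key, key]
  exact (h2.isSymmSndFDerivAt (by simp)) _ _

/-! ### The wave operator in Bondi coordinates. -/

theorem norm_sphericalPoint {r : ℝ} (hr : 0 ≤ r) (θ φ : ℝ) : ‖sphericalPoint r θ φ‖ = r := by
  rw [EuclideanSpace.norm_eq, Real.sqrt_eq_iff_eq_sq (by positivity) hr]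
  simp only [sphericalPoint, Fin.sum_univ_three, Real.norm_eq_abs, sq_abs]
  simp only [Matrix.cons_val_zero, Matrix.cons_val_one, Matrix.cons_val]
  linear_combination r ^ 2 * Real.sin θ ^ 2 * Real.sin_sq_add_cos_sq φ +
    r ^ 2 * Real.sin_sq_add_cos_sq θ

theorem contDiffOn_inBondi {R : ℝ} (hR : 0 < R) {ψ : ℝ × EuclideanSpace ℝ (Fin 3) → ℝ}
    (hψ : ContDiffOn ℝ ∞ ψ (farRegion R)) : ContDiffOn ℝ ∞ (inBondi ψ) (bondiDomain R) := by
  refine hψ.comp (g := ψ) (f := fun x : Fin 4 → ℝ => (x 0, sphericalPoint (x 1) (x 2) (x 3)))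
    (ContDiff.contDiffOn ?_) ?_
  · refine (contDiff_apply ℝ ℝ 0).prodMk ?_
    rw [contDiff_euclidean]
    have h : ∀ i : Fin 4, ContDiff ℝ ∞ fun x : Fin 4 → ℝ => x i := fun i => contDiff_apply ℝ ℝ i
    intro i
    fin_cases i
    · exact ((h 1).mul (Real.contDiff_sin.comp (h 2))).mul (Real.contDiff_cos.comp (h 3))
    · exact ((h 1).mul (Real.contDiff_sin.comp (h 2))).mul (Real.contDiff_sin.comp (h 3))
    · exact (h 1).mul (Real.contDiff_cos.comp (h 2))
  · rintro x ⟨h0, h1⟩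
    refine ⟨h0, ?_⟩
    rw [norm_sphericalPoint (hR.trans h1).le]
    exact h1.le

theorem det_bondiMetric (D : ℝ → ℝ) (x : Fin 4 → ℝ) :
    (bondiMetric D x).det = -(x 1 ^ 4 * Real.sin (x 2) ^ 2) := by
  simp [bondiMetric, Matrix.det_succ_row_zero, Fin.sum_univ_succ, Fin.succAbove]
  ring

theorem sqrt_det_bondiMetric (D : ℝ → ℝ) {x : Fin 4 → ℝ} (hs : 0 < Real.sin (x 2)) :
    √|(bondiMetric D x).det| = x 1 ^ 2 * Real.sin (x 2) := by
  rw [det_bondiMetric, abs_neg, abs_of_nonneg (by positivity),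
    show x 1 ^ 4 * Real.sin (x 2) ^ 2 = (x 1 ^ 2 * Real.sin (x 2)) ^ 2 by ring,
    Real.sqrt_sq (by positivity)]

theorem inv_bondiMetric (D : ℝ → ℝ) {x : Fin 4 → ℝ} (hr : x 1 ≠ 0) (hs : Real.sin (x 2) ≠ 0) :
    (bondiMetric D x)⁻¹ = !![0, -1, 0, 0; -1, D (x 1), 0, 0; 0, 0, (x 1 ^ 2)⁻¹, 0;
      0, 0, 0, (x 1 ^ 2 * Real.sin (x 2) ^ 2)⁻¹] := by
  refine Matrix.inv_eq_right_inv ?_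
  ext i j
  fin_cases i <;> fin_cases j <;>
    simp [bondiMetric, Matrix.mul_apply, Fin.sum_univ_succ, hr]
  field_simp

theorem pderiv_congr {i : Fin 4} {f g : (Fin 4 → ℝ) → ℝ} {x : Fin 4 → ℝ} (h : f =ᶠ[𝓝 x] g) :
    pderiv i f x = pderiv i g x := by
  have hc : Continuous (Function.update x i) := continuous_const.update i continuous_id
  have ht : Tendsto (Function.update x i) (𝓝 (x i)) (𝓝 x) := by
    have := hc.tendsto (x i)
    rwa [Function.update_eq_self] at this
  exact (h.comp_tendsto ht).deriv_eq

theorem flux_bondiMetric (D : ℝ → ℝ) {R : ℝ} (hR : 0 < R) {f : (Fin 4 → ℝ) → ℝ}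
    (hf : ContDiffOn ℝ ∞ f (bondiDomain R)) {y : Fin 4 → ℝ} (h0 : 0 < y 0) (h1 : R < y 1)
    (hs : 0 < Real.sin (y 2)) (a : Fin 4) :
    √|(bondiMetric D y).det| * ∑ b : Fin 4, (bondiMetric D y)⁻¹ a b * pderiv b f y =
      ![y 1 ^ 2 * Real.sin (y 2) * -dWithin R 1 f y,
        y 1 ^ 2 * Real.sin (y 2) * (-dWithin R 0 f y + D (y 1) * dWithin R 1 f y),
        Real.sin (y 2) * dWithin R 2 f y, (Real.sin (y 2))⁻¹ * dWithin R 3 f y] a := by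
  have hr : y 1 ≠ 0 := (hR.trans h1).ne'
  have hs' := hs.ne'
  rw [sqrt_det_bondiMetric D hs, inv_bondiMetric D hr hs']
  simp only [pderiv_eq_dWithin hf h0 h1]
  fin_cases a <;> simp [Fin.sum_univ_succ] <;> field_simp

/-- This is `r² sin θ · □f`. In this normalisation the radial part carries the area density `sin θ`,
while the rest is `∂_θ (sin θ ∂_θ f)` plus a `φ`-derivative, ready for integration over the sphere.
-/
theorem wave_eq_expanded {D D' : ℝ → ℝ} {R : ℝ} (hR : 0 < R)
    (hD : ∀ r, R < r → HasDerivAt D (D' r) r) {f : (Fin 4 → ℝ) → ℝ}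
    (hf : ContDiffOn ℝ ∞ f (bondiDomain R)) {x : Fin 4 → ℝ} (h0 : 0 < x 0) (h1 : R < x 1)
    (hs : 0 < Real.sin (x 2)) (hw : waveOp (bondiMetric D) f x = 0) :
    Real.sin (x 2) * (-2 * x 1 ^ 2 * dWithin R 0 (dWithin R 1 f) x - 2 * x 1 * dWithin R 0 f x +
        (2 * x 1 * D (x 1) + x 1 ^ 2 * D' (x 1)) * dWithin R 1 f x +
        x 1 ^ 2 * D (x 1) * dWithin R 1 (dWithin R 1 f) x) +
      (Real.cos (x 2) * dWithin R 2 f x + Real.sin (x 2) * dWithin R 2 (dWithin R 2 f) x) +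
      (Real.sin (x 2))⁻¹ * dWithin R 3 (dWithin R 3 f) x = 0 := by
  have hr : x 1 ≠ 0 := (hR.trans h1).ne'
  have hev : ∀ᶠ y in 𝓝 x, 0 < y 0 ∧ R < y 1 ∧ 0 < Real.sin (y 2) := by
    have ho : IsOpen {y : Fin 4 → ℝ | 0 < Real.sin (y 2)} :=
      isOpen_lt continuous_const (Real.continuous_sin.comp (continuous_apply 2))
    filter_upwards [(isOpen_bondiInterior R).mem_nhds ⟨h0, h1⟩, ho.mem_nhds hs] with y hy hy'
    exact ⟨hy.1, hy.2, hy'⟩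
  have hpd : ∀ a : Fin 4, pderiv a (fun y => √|(bondiMetric D y).det| *
      ∑ b : Fin 4, (bondiMetric D y)⁻¹ a b * pderiv b f y) x = pderiv a (fun y =>
      ![y 1 ^ 2 * Real.sin (y 2) * -dWithin R 1 f y,
        y 1 ^ 2 * Real.sin (y 2) * (-dWithin R 0 f y + D (y 1) * dWithin R 1 f y),
        Real.sin (y 2) * dWithin R 2 f y, (Real.sin (y 2))⁻¹ * dWithin R 3 f y] a) x := by
    intro a
    refine pderiv_congr ?_
    filter_upwards [hev] with y hy
    exact flux_bondiMetric D hR hf hy.1 hy.2.1 hy.2.2 a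
  rw [waveOp, sqrt_det_bondiMetric D hs, Finset.sum_congr rfl fun a _ => hpd a] at hw
  have hne : (x 1 ^ 2 * Real.sin (x 2))⁻¹ ≠ 0 := by
    have := hs.ne'
    positivity
  have hsum := (mul_eq_zero.1 hw).resolve_left hne
  have hx : x ∈ bondiDomain R := ⟨h0.le, h1⟩
  have hd : ∀ i j : Fin 4, HasDerivAt (fun t => dWithin R i f (Function.update x j t))
      (dWithin R j (dWithin R i f) x) (x j) := fun i j =>
    hasDerivAt_update_dWithin (contDiffOn_dWithin hf i) hx fun _ => h0
  have e0 : pderiv 0 (fun y => y 1 ^ 2 * Real.sin (y 2) * -dWithin R 1 f y) x =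
      x 1 ^ 2 * Real.sin (x 2) * -dWithin R 0 (dWithin R 1 f) x := by
    refine HasDerivAt.deriv ?_
    simpa using ((hd 1 0).neg.const_mul (x 1 ^ 2 * Real.sin (x 2)))
  have e1 : pderiv 1 (fun y => y 1 ^ 2 * Real.sin (y 2) *
      (-dWithin R 0 f y + D (y 1) * dWithin R 1 f y)) x =
      2 * x 1 * Real.sin (x 2) * (-dWithin R 0 f x + D (x 1) * dWithin R 1 f x) +
      x 1 ^ 2 * Real.sin (x 2) * (-dWithin R 1 (dWithin R 0 f) x +
        (D' (x 1) * dWithin R 1 f x + D (x 1) * dWithin R 1 (dWithin R 1 f) x)) := by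
    have h := ((((hasDerivAt_id' (x 1)).pow 2).mul_const (Real.sin (x 2))).mul
      ((hd 0 1).neg.add ((hD (x 1) h1).mul (hd 1 1)))).deriv
    simp only [Pi.add_apply, Pi.mul_apply, Pi.neg_apply, Pi.pow_apply, Function.update_eq_self]
      at h
    rw [pderiv]
    simp only [Function.update_self, Function.update_of_ne (show (2 : Fin 4) ≠ 1 by decide)]
    refine Eq.trans ?_ (h.trans ?_)
    · rfl
    · push_cast; ring
  have e2 : pderiv 2 (fun y => Real.sin (y 2) * dWithin R 2 f y) x =
      Real.cos (x 2) * dWithin R 2 f x + Real.sin (x 2) * dWithin R 2 (dWithin R 2 f) x := by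
    have h := ((Real.hasDerivAt_sin (x 2)).mul (hd 2 2)).deriv
    simp only [Function.update_eq_self] at h
    rw [pderiv]
    simp only [Function.update_self]
    exact h
  have e3 : pderiv 3 (fun y => (Real.sin (y 2))⁻¹ * dWithin R 3 f y) x =
      (Real.sin (x 2))⁻¹ * dWithin R 3 (dWithin R 3 f) x := by
    refine HasDerivAt.deriv ?_
    simpa using (hd 3 3).const_mul (Real.sin (x 2))⁻¹
  simp only [Fin.sum_univ_four, Matrix.cons_val_zero, Matrix.cons_val_one, Matrix.cons_val] at hsum
  rw [e0, e1, e2, e3, dWithin_comm hf h0 h1 1 0] at hsum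
  linear_combination hsum

/-! ### Integration over spheres. -/

/-- The integral over the unit sphere of a function in Bondi coordinates. -/
def sphereIntegral (f : (Fin 4 → ℝ) → ℝ) (u r : ℝ) : ℝ :=
  ∫ θ in (0 : ℝ)..Real.pi, ∫ φ in (0 : ℝ)..(2 * Real.pi), f ![u, r, θ, φ] * Real.sin θ

theorem update_zero_vec (u r θ φ t : ℝ) : Function.update ![u, r, θ, φ] 0 t = ![t, r, θ, φ] := by
  ext i; fin_cases i <;> simp

theorem update_one_vec (u r θ φ t : ℝ) : Function.update ![u, r, θ, φ] 1 t = ![u, t, θ, φ] := by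
  ext i; fin_cases i <;> simp

theorem update_two_vec (u r θ φ t : ℝ) : Function.update ![u, r, θ, φ] 2 t = ![u, r, t, φ] := by
  ext i; fin_cases i <;> simp

theorem update_three_vec (u r θ φ t : ℝ) : Function.update ![u, r, θ, φ] 3 t = ![u, r, θ, t] := by
  ext i; fin_cases i <;> simp

theorem continuous_vec {X : Type*} [TopologicalSpace X] {a b c d : X → ℝ} (ha : Continuous a)
    (hb : Continuous b) (hc : Continuous c) (hd : Continuous d) :
    Continuous fun x => (![a x, b x, c x, d x] : Fin 4 → ℝ) := by
  refine continuous_pi fun i => ?_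
  fin_cases i <;> assumption

section SphereIntegral

variable {R : ℝ} {f : (Fin 4 → ℝ) → ℝ}

theorem continuousOn_sphereIntegrand (hf : ContinuousOn f (bondiDomain R)) :
    ContinuousOn (fun p : ((ℝ × ℝ) × ℝ) × ℝ => f ![p.1.1.1, p.1.1.2, p.1.2, p.2] * Real.sin p.1.2)
      (((Ici 0 ×ˢ Ioi R) ×ˢ univ) ×ˢ univ) := by
  refine ContinuousOn.mul (hf.comp (continuous_vec ?_ ?_ ?_ ?_).continuousOn ?_) ?_
  any_goals fun_prop
  rintro ⟨⟨⟨u, r⟩, θ⟩, φ⟩ ⟨⟨⟨hu, hr⟩, -⟩, -⟩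
  exact ⟨hu, hr⟩

theorem continuousOn_integral_azimuth (hf : ContinuousOn f (bondiDomain R)) :
    ContinuousOn (fun p : (ℝ × ℝ) × ℝ =>
      ∫ φ in (0 : ℝ)..(2 * Real.pi), f ![p.1.1, p.1.2, p.2, φ] * Real.sin p.2)
      ((Ici 0 ×ˢ Ioi R) ×ˢ univ) :=
  continuousOn_intervalIntegral_param (f := fun (p : (ℝ × ℝ) × ℝ) φ =>
    f ![p.1.1, p.1.2, p.2, φ] * Real.sin p.2) Real.two_pi_pos.le
    ((continuousOn_sphereIntegrand hf).mono (prod_mono subset_rfl (subset_univ _)))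

theorem continuousOn_sphereIntegral (hf : ContinuousOn f (bondiDomain R)) :
    ContinuousOn (Function.uncurry (sphereIntegral f)) (Ici 0 ×ˢ Ioi R) :=
  continuousOn_intervalIntegral_param (f := fun (p : ℝ × ℝ) θ =>
    ∫ φ in (0 : ℝ)..(2 * Real.pi), f ![p.1, p.2, θ, φ] * Real.sin θ) Real.pi_pos.le
    ((continuousOn_integral_azimuth hf).mono (prod_mono subset_rfl (subset_univ _)))

theorem hasDerivAt_sphereIntegral_radius (hf : ContDiffOn ℝ ∞ f (bondiDomain R)) {u r : ℝ}
    (hu : 0 ≤ u) (hr : R < r) :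
    HasDerivAt (sphereIntegral f u) (sphereIntegral (dWithin R 1 f) u r) r := by
  have hc := (contDiffOn_dWithin hf 1).continuousOn
  refine hasDerivAt_intervalIntegral_param (f := fun r θ =>
    ∫ φ in (0 : ℝ)..(2 * Real.pi), f ![u, r, θ, φ] * Real.sin θ) (f' := fun r θ =>
    ∫ φ in (0 : ℝ)..(2 * Real.pi), dWithin R 1 f ![u, r, θ, φ] * Real.sin θ)
    Real.pi_pos.le (Ioi_mem_nhds hr) ?_ ?_ ?_
  · intro s hs
    exact (continuousOn_integral_azimuth hf.continuousOn).comp (f := fun θ => ((u, s), θ))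
      (by fun_prop) fun θ _ => ⟨⟨hu, hs⟩, mem_univ _⟩
  · exact (continuousOn_integral_azimuth hc).comp (f := fun p : ℝ × ℝ => ((u, p.1), p.2))
      (by fun_prop) fun p hp => ⟨⟨hu, hp.1⟩, mem_univ _⟩
  · intro s hs θ _
    refine hasDerivAt_intervalIntegral_param (f := fun r φ => f ![u, r, θ, φ] * Real.sin θ)
      (f' := fun r φ => dWithin R 1 f ![u, r, θ, φ] * Real.sin θ)
      Real.two_pi_pos.le (Ioi_mem_nhds hs) ?_ ?_ ?_
    · intro t ht
      exact (continuousOn_sphereIntegrand hf.continuousOn).comp (f := fun φ => (((u, t), θ), φ))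
        (by fun_prop) fun φ _ => ⟨⟨⟨hu, ht⟩, mem_univ _⟩, mem_univ _⟩
    · exact (continuousOn_sphereIntegrand hc).comp (f := fun p : ℝ × ℝ => (((u, p.1), θ), p.2))
        (by fun_prop) fun p hp => ⟨⟨⟨hu, hp.1⟩, mem_univ _⟩, mem_univ _⟩
    · intro t ht φ _
      have := hasDerivAt_update_dWithin hf (x := ![u, t, θ, φ]) ⟨hu, ht⟩ (i := 1) (by simp)
      simp only [update_one_vec] at this
      exact this.mul_const _

theorem hasDerivAt_sphereIntegral_time (hf : ContDiffOn ℝ ∞ f (bondiDomain R)) {u r : ℝ}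
    (hu : 0 < u) (hr : R < r) :
    HasDerivAt (fun u => sphereIntegral f u r) (sphereIntegral (dWithin R 0 f) u r) u := by
  have hc := (contDiffOn_dWithin hf 0).continuousOn
  refine hasDerivAt_intervalIntegral_param (f := fun u θ =>
    ∫ φ in (0 : ℝ)..(2 * Real.pi), f ![u, r, θ, φ] * Real.sin θ) (f' := fun u θ =>
    ∫ φ in (0 : ℝ)..(2 * Real.pi), dWithin R 0 f ![u, r, θ, φ] * Real.sin θ)
    Real.pi_pos.le (Ioi_mem_nhds hu) ?_ ?_ ?_
  · intro s hs
    exact (continuousOn_integral_azimuth hf.continuousOn).comp (f := fun θ => ((s, r), θ))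
      (by fun_prop) fun θ _ => ⟨⟨le_of_lt (mem_Ioi.1 hs), hr⟩, mem_univ _⟩
  · exact (continuousOn_integral_azimuth hc).comp (f := fun p : ℝ × ℝ => ((p.1, r), p.2))
      (by fun_prop) fun p hp => ⟨⟨le_of_lt (mem_Ioi.1 hp.1), hr⟩, mem_univ _⟩
  · intro s hs θ _
    refine hasDerivAt_intervalIntegral_param (f := fun u φ => f ![u, r, θ, φ] * Real.sin θ)
      (f' := fun u φ => dWithin R 0 f ![u, r, θ, φ] * Real.sin θ)
      Real.two_pi_pos.le (Ioi_mem_nhds hs) ?_ ?_ ?_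
    · intro t ht
      exact (continuousOn_sphereIntegrand hf.continuousOn).comp (f := fun φ => (((t, r), θ), φ))
        (by fun_prop) fun φ _ => ⟨⟨⟨le_of_lt (mem_Ioi.1 ht), hr⟩, mem_univ _⟩, mem_univ _⟩
    · exact (continuousOn_sphereIntegrand hc).comp (f := fun p : ℝ × ℝ => (((p.1, r), θ), p.2))
        (by fun_prop) fun p hp => ⟨⟨⟨le_of_lt (mem_Ioi.1 hp.1), hr⟩, mem_univ _⟩, mem_univ _⟩
    · intro t ht φ _
      have := hasDerivAt_update_dWithin hf (x := ![t, r, θ, φ]) ⟨le_of_lt (mem_Ioi.1 ht), hr⟩ (i := 0) (fun _ => ht)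
      simp only [update_zero_vec] at this
      exact this.mul_const _

end SphereIntegral

section SphereIntegral

variable {R : ℝ} {f g : (Fin 4 → ℝ) → ℝ}

theorem continuous_azimuth (hf : ContinuousOn f (bondiDomain R)) {u r : ℝ} (hu : 0 ≤ u)
    (hr : R < r) (θ : ℝ) : Continuous fun φ => f ![u, r, θ, φ] :=
  hf.comp_continuous (continuous_vec (by fun_prop) (by fun_prop) (by fun_prop) (by fun_prop))
    fun _ => ⟨hu, hr⟩

theorem sphereIntegral_add (hf : ContinuousOn f (bondiDomain R))
    (hg : ContinuousOn g (bondiDomain R)) {u r : ℝ} (hu : 0 ≤ u) (hr : R < r) :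
    sphereIntegral (fun x => f x + g x) u r = sphereIntegral f u r + sphereIntegral g u r := by
  have hi : ∀ {h : (Fin 4 → ℝ) → ℝ}, ContinuousOn h (bondiDomain R) → IntervalIntegrable
      (fun θ => ∫ φ in (0 : ℝ)..(2 * Real.pi), h ![u, r, θ, φ] * Real.sin θ) volume 0 Real.pi :=
    fun hh => ContinuousOn.intervalIntegrable
      ((continuousOn_integral_azimuth hh).comp (f := fun θ => ((u, r), θ)) (by fun_prop)
        fun θ _ => ⟨⟨hu, hr⟩, mem_univ _⟩)
  rw [sphereIntegral, sphereIntegral, sphereIntegral, ← intervalIntegral.integral_add (hi hf) (hi hg)]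
  refine intervalIntegral.integral_congr fun θ _ => ?_
  simp only [add_mul]
  exact intervalIntegral.integral_add
    (((continuous_azimuth hf hu hr θ).mul continuous_const).intervalIntegrable _ _)
    (((continuous_azimuth hg hu hr θ).mul continuous_const).intervalIntegrable _ _)

theorem sphereIntegral_const_mul (c u r : ℝ) :
    sphereIntegral (fun x => c * f x) u r = c * sphereIntegral f u r := by
  simp only [sphereIntegral, mul_assoc, intervalIntegral.integral_const_mul]

/-- The integral of the angular part of the wave operator over the sphere vanishes. -/
theorem sphereIntegral_eq_zero_of_angular (hf : ContDiffOn ℝ ∞ f (bondiDomain R)) {u r : ℝ}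
    (hu : 0 ≤ u) (hr : R < r)
    (hper : ∀ θ φ, f ![u, r, θ, φ + 2 * Real.pi] = f ![u, r, θ, φ])
    (h : ∀ θ ∈ Ioo 0 Real.pi, ∀ φ ∈ Ioo 0 (2 * Real.pi), g ![u, r, θ, φ] * Real.sin θ +
      (Real.cos θ * dWithin R 2 f ![u, r, θ, φ] +
        Real.sin θ * dWithin R 2 (dWithin R 2 f) ![u, r, θ, φ]) +
      (Real.sin θ)⁻¹ * dWithin R 3 (dWithin R 3 f) ![u, r, θ, φ] = 0) :
    sphereIntegral g u r = 0 := by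
  have h2 := contDiffOn_dWithin hf 2
  have h3 := contDiffOn_dWithin hf 3
  have h22 := contDiffOn_dWithin h2 2
  have h33 := contDiffOn_dWithin h3 3
  have hcont : ∀ {k : (Fin 4 → ℝ) → ℝ}, ContinuousOn k (bondiDomain R) →
      Continuous fun p : ℝ × ℝ => k ![u, r, p.1, p.2] := fun hk =>
    hk.comp_continuous (continuous_vec (by fun_prop) (by fun_prop) (by fun_prop) (by fun_prop))
      fun _ => ⟨hu, hr⟩
  have c2 := hcont h2.continuousOn
  have c22 := hcont h22.continuousOn
  have hq' : Continuous fun p : ℝ × ℝ => Real.cos p.1 * dWithin R 2 f ![u, r, p.1, p.2] +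
      Real.sin p.1 * dWithin R 2 (dWithin R 2 f) ![u, r, p.1, p.2] := by fun_prop
  have hq : ∀ θ, HasDerivAt
      (fun θ => ∫ φ in (0 : ℝ)..(2 * Real.pi), Real.sin θ * dWithin R 2 f ![u, r, θ, φ])
      (∫ φ in (0 : ℝ)..(2 * Real.pi), (Real.cos θ * dWithin R 2 f ![u, r, θ, φ] +
        Real.sin θ * dWithin R 2 (dWithin R 2 f) ![u, r, θ, φ])) θ := fun θ =>
    hasDerivAt_intervalIntegral_param
      (f := fun θ φ => Real.sin θ * dWithin R 2 f ![u, r, θ, φ])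
      (f' := fun θ φ => Real.cos θ * dWithin R 2 f ![u, r, θ, φ] +
        Real.sin θ * dWithin R 2 (dWithin R 2 f) ![u, r, θ, φ])
      Real.two_pi_pos.le univ_mem
      (fun θ _ => (continuous_const.mul
        (continuous_azimuth h2.continuousOn hu hr θ)).continuousOn)
      hq'.continuousOn fun θ _ φ _ => by
        have := hasDerivAt_update_dWithin h2 (x := ![u, r, θ, φ]) ⟨hu, hr⟩ (i := 2)
          (fun h => absurd h (by decide))
        simp only [update_two_vec] at this
        exact (Real.hasDerivAt_sin θ).mul this
  have hθ : ∫ θ in (0 : ℝ)..Real.pi, ∫ φ in (0 : ℝ)..(2 * Real.pi),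
      (Real.cos θ * dWithin R 2 f ![u, r, θ, φ] +
        Real.sin θ * dWithin R 2 (dWithin R 2 f) ![u, r, θ, φ]) = 0 := by
    -- The primitive carries the factor `sin θ`, which vanishes at both poles.
    rw [intervalIntegral.integral_eq_sub_of_hasDerivAt (fun θ _ => hq θ)]
    · simp
    · exact (intervalIntegral.continuous_parametric_intervalIntegral_of_continuous' (μ := volume)
        (f := fun θ φ => Real.cos θ * dWithin R 2 f ![u, r, θ, φ] +
          Real.sin θ * dWithin R 2 (dWithin R 2 f) ![u, r, θ, φ]) hq' _ _).intervalIntegrable _ _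
  have hφ : ∀ θ, ∫ φ in (0 : ℝ)..(2 * Real.pi),
      dWithin R 3 (dWithin R 3 f) ![u, r, θ, φ] = 0 := by
    intro θ
    have hd : ∀ {k : (Fin 4 → ℝ) → ℝ}, ContDiffOn ℝ ∞ k (bondiDomain R) → ∀ φ,
        HasDerivAt (fun t => k ![u, r, θ, t]) (dWithin R 3 k ![u, r, θ, φ]) φ := by
      intro k hk φ
      have := hasDerivAt_update_dWithin hk (x := ![u, r, θ, φ]) ⟨hu, hr⟩ (i := 3)
        (fun h => absurd h (by decide))
      simp only [update_three_vec] at this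
      exact this
    rw [intervalIntegral.integral_eq_sub_of_hasDerivAt (fun φ _ => hd h3 φ)
      ((continuous_azimuth h33.continuousOn hu hr θ).intervalIntegrable _ _), sub_eq_zero]
    -- Periodicity of `f` passes to its azimuthal derivative by uniqueness of derivatives, so the
    -- endpoint values agree.
    have e1 := hd hf (0 + 2 * Real.pi)
    have e2 := e1.comp_add_const (0 : ℝ) (2 * Real.pi)
    simp only [hper] at e2
    rw [zero_add] at e2
    exact e2.unique (hd hf 0)
  -- The equation holds only in the open chart; the omitted pole and meridian are null sets.
  have hae : ∀ c : ℝ, ∀ᵐ x : ℝ, x ≠ c := fun c => by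
    simp [ae_iff, measure_singleton]
  refine neg_eq_zero.1 (Eq.trans (intervalIntegral.integral_neg.symm.trans ?_) hθ)
  refine intervalIntegral.integral_congr_ae ?_
  filter_upwards [hae Real.pi] with θ hθπ hθm
  rw [uIoc_of_le Real.pi_pos.le] at hθm
  have hθI : θ ∈ Ioo 0 Real.pi := ⟨hθm.1, lt_of_le_of_ne hθm.2 hθπ⟩
  have hsplit : ∫ φ in (0 : ℝ)..(2 * Real.pi), (Real.cos θ * dWithin R 2 f ![u, r, θ, φ] +
        Real.sin θ * dWithin R 2 (dWithin R 2 f) ![u, r, θ, φ]) =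
      ∫ φ in (0 : ℝ)..(2 * Real.pi), ((Real.cos θ * dWithin R 2 f ![u, r, θ, φ] +
        Real.sin θ * dWithin R 2 (dWithin R 2 f) ![u, r, θ, φ]) +
        (Real.sin θ)⁻¹ * dWithin R 3 (dWithin R 3 f) ![u, r, θ, φ]) := by
    have i1 : IntervalIntegrable (fun φ => Real.cos θ * dWithin R 2 f ![u, r, θ, φ] +
        Real.sin θ * dWithin R 2 (dWithin R 2 f) ![u, r, θ, φ]) volume 0 (2 * Real.pi) :=
      (hq'.comp (by fun_prop : Continuous fun φ : ℝ => (θ, φ))).intervalIntegrable _ _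
    have i2 : IntervalIntegrable (fun φ => (Real.sin θ)⁻¹ *
        dWithin R 3 (dWithin R 3 f) ![u, r, θ, φ]) volume 0 (2 * Real.pi) :=
      (continuous_const.mul (continuous_azimuth h33.continuousOn hu hr θ)).intervalIntegrable _ _
    refine Eq.trans ?_ (intervalIntegral.integral_add i1 i2).symm
    rw [intervalIntegral.integral_const_mul, hφ, mul_zero, add_zero]
  rw [hsplit]
  refine intervalIntegral.integral_neg.symm.trans ?_
  refine intervalIntegral.integral_congr_ae ?_
  filter_upwards [hae (2 * Real.pi)] with φ hφπ hφm
  rw [uIoc_of_le Real.two_pi_pos.le] at hφm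
  have := h θ hθI φ ⟨hφm.1, lt_of_le_of_ne hφm.2 hφπ⟩
  linear_combination -this

end SphereIntegral

/-! ### Reduction to a wave equation in `u` and `r`. -/

/-- A solution `φ = r ψ₀` of the spherically symmetric wave equation
`2 ∂_u ∂_r φ = ∂_r (D ∂_r φ) - (D' / r) φ` on `u ≥ 0`, `r > R`, with `Φ = ∂_r φ`, `Φr = ∂_r² φ`. -/
structure IsSphericalWave (R : ℝ) (D D' : ℝ → ℝ) (φ Φ Φr : ℝ → ℝ → ℝ) : Prop where
  continuousOn_field : ContinuousOn (Function.uncurry φ) (Ici 0 ×ˢ Ioi R)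
  continuousOn_dr : ContinuousOn (Function.uncurry Φ) (Ici 0 ×ˢ Ioi R)
  continuousOn_drr : ContinuousOn (Function.uncurry Φr) (Ici 0 ×ˢ Ioi R)
  hasDerivAt_field : ∀ u r, 0 ≤ u → R < r → HasDerivAt (φ u) (Φ u r) r
  hasDerivAt_dr : ∀ u r, 0 ≤ u → R < r → HasDerivAt (Φ u) (Φr u r) r
  evolution : ∀ u r, 0 < u → R < r → HasDerivAt (fun u => Φ u r)
    ((D r * Φr u r + D' r * Φ u r - D' r / r * φ u r) / 2) u

/-- Integrating the expanded equation over the sphere leaves an equation for the mean `m` alone;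
rewriting it through `φ = r m` and `Φ = m + r ∂_r m` removes every undifferentiated `∂_u m` term. -/
theorem IsLinearWave.isSphericalWave {D D' : ℝ → ℝ} {R : ℝ} (hR : 0 < R)
    (hD : ∀ r, R < r → HasDerivAt D (D' r) r) {ψ : ℝ × EuclideanSpace ℝ (Fin 3) → ℝ}
    (hψ : IsLinearWave D R ψ) : ∃ φ Φr : ℝ → ℝ → ℝ, ∃ Φ : ℝ → ℝ → ℝ,
      IsSphericalWave R D D' φ Φ Φr ∧ ∀ u r, 0 ≤ u → R < r → drRadiationField ψ u r = Φ u r := by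
  set f := inBondi ψ with hfdef
  have hf : ContDiffOn ℝ ∞ f (bondiDomain R) := contDiffOn_inBondi hR hψ.smooth
  have h0 := contDiffOn_dWithin hf 0
  have h1 := contDiffOn_dWithin hf 1
  have h11 := contDiffOn_dWithin h1 1
  have h01 := contDiffOn_dWithin h1 0
  set c : ℝ := (4 * Real.pi)⁻¹ with hc
  have m := continuousOn_sphereIntegral hf.continuousOn
  have m1 := continuousOn_sphereIntegral h1.continuousOn
  have m11 := continuousOn_sphereIntegral h11.continuousOn
  have heq : ∀ u r, 0 < u → R < r →
      -2 * r ^ 2 * sphereIntegral (dWithin R 0 (dWithin R 1 f)) u r +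
      (-2 * r * sphereIntegral (dWithin R 0 f) u r +
        ((2 * r * D r + r ^ 2 * D' r) * sphereIntegral (dWithin R 1 f) u r +
          r ^ 2 * D r * sphereIntegral (dWithin R 1 (dWithin R 1 f)) u r)) = 0 := by
    intro u r hu hr
    simp only [← sphereIntegral_const_mul]
    rw [← sphereIntegral_add (R := R) _ _ hu.le hr, ← sphereIntegral_add (R := R) _ _ hu.le hr,
      ← sphereIntegral_add (R := R) _ _ hu.le hr]
    · refine sphereIntegral_eq_zero_of_angular hf hu.le hr ?_ ?_
      · intro θ φ
        simp [hfdef, inBondi, sphericalPoint]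
      · intro θ hθ φ hφ
        have hs : 0 < Real.sin θ := Real.sin_pos_of_mem_Ioo hθ
        have := wave_eq_expanded hR hD hf (x := ![u, r, θ, φ]) hu hr hs
          (hψ.wave_eq u r θ φ hu hr hθ hφ)
        simp only [Matrix.cons_val_one, Matrix.cons_val_zero, Matrix.cons_val] at this
        linear_combination this
    all_goals
      have := h0.continuousOn
      have := h1.continuousOn
      have := h11.continuousOn
      have := h01.continuousOn
      fun_prop
  refine ⟨fun u r => r * (c * sphereIntegral f u r),
    fun u r => c * (2 * sphereIntegral (dWithin R 1 f) u r +
      r * sphereIntegral (dWithin R 1 (dWithin R 1 f)) u r),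
    fun u r => c * (sphereIntegral f u r + r * sphereIntegral (dWithin R 1 f) u r),
    ⟨?_, ?_, ?_, ?_, ?_, ?_⟩, ?_⟩
  · exact continuousOn_snd.mul (continuousOn_const.mul m)
  · exact continuousOn_const.mul (m.add (continuousOn_snd.mul m1))
  · exact continuousOn_const.mul ((continuousOn_const.mul m1).add (continuousOn_snd.mul m11))
  · intro u r hu hr
    exact ((hasDerivAt_id' r).mul ((hasDerivAt_sphereIntegral_radius hf hu hr).const_mul c)).congr_deriv
      (by ring)
  · intro u r hu hr
    exact (((hasDerivAt_sphereIntegral_radius hf hu hr).add ((hasDerivAt_id' r).mul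
      (hasDerivAt_sphereIntegral_radius h1 hu hr))).const_mul c).congr_deriv (by ring)
  · intro u r hu hr
    refine (((hasDerivAt_sphereIntegral_time hf hu hr).add
      ((hasDerivAt_sphereIntegral_time h1 hu hr).const_mul r)).const_mul c).congr_deriv ?_
    have hr0 : r ≠ 0 := (hR.trans hr).ne'
    have := heq u r hu hr
    field_simp
    have h2 : r * (2 * r * sphereIntegral (dWithin R 0 (dWithin R 1 f)) u r +
      2 * sphereIntegral (dWithin R 0 f) u r -
        ((2 * D r + r * D' r) * sphereIntegral (dWithin R 1 f) u r +
          r * D r * sphereIntegral (dWithin R 1 (dWithin R 1 f)) u r)) = 0 := by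
      linear_combination -this
    have h3 := (mul_eq_zero.1 h2).resolve_left hr0
    linear_combination c * h3
  · intro u r hu hr
    have : HasDerivAt (fun s : ℝ => s * sphericalMean ψ u s)
        (c * (sphereIntegral f u r + r * sphereIntegral (dWithin R 1 f) u r)) r :=
      ((hasDerivAt_id' r).mul
        ((hasDerivAt_sphereIntegral_radius hf hu hr).const_mul c)).congr_deriv (by ring)
    exact this.deriv

/-! ### Bounds on the metric coefficient. -/

section MetricCoefficient

variable {R M β : ℝ} {D : ℝ → ℝ}

theorem IsAsymptoticallyFlat.hasDerivAt (hD : IsAsymptoticallyFlat R M β D) {r : ℝ} (hr : R < r) :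
    HasDerivAt D (deriv D r) r :=
  ((hD.smooth.contDiffAt (Ici_mem_nhds hr)).differentiableAt (by simp)).hasDerivAt

theorem IsAsymptoticallyFlat.continuousOn_deriv (hD : IsAsymptoticallyFlat R M β D) :
    ContinuousOn (deriv D) (Ioi R) :=
  (hD.smooth.mono Ioi_subset_Ici_self).continuousOn_deriv_of_isOpen isOpen_Ioi (by simp)

theorem IsAsymptoticallyFlat.exists_abs_le (hD : IsAsymptoticallyFlat R M β D) :
    ∃ K : ℝ, 0 < K ∧ ∀ r, R < r → |D r| ≤ K := by
  obtain ⟨C, hC, h⟩ := hD.asymptotics 0 (by norm_num)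
  have hR := hD.R_pos
  have hM := hD.M_nonneg
  refine ⟨1 + 2 * M / R + C * R ^ (-(1 + β)), by positivity, fun r hr => ?_⟩
  have h0 := h r hr.le
  have hr0 : 0 < r := hR.trans hr
  simp only [iteratedDerivWithin_zero, Nat.cast_zero, sub_zero] at h0
  have h1 : r ^ (-(1 + β)) ≤ R ^ (-(1 + β)) :=
    Real.rpow_le_rpow_of_nonpos hR hr.le (by linarith [hD.β_pos])
  have h2 : 2 * M / r ≤ 2 * M / R := by gcongr
  have h3 : 0 ≤ 2 * M / r := by positivity
  have h4 := mul_le_mul_of_nonneg_left h1 hC.le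
  rw [abs_le] at h0 ⊢
  constructor <;> linarith [h0.1, h0.2]

/-- The mass term decays exactly like `r⁻²`, and the error, of order `r^(-2-β)`, is absorbed because
`r^(-β) ≤ R^(-β)`. -/
theorem IsAsymptoticallyFlat.exists_abs_deriv_le (hD : IsAsymptoticallyFlat R M β D) :
    ∃ C : ℝ, 0 < C ∧ ∀ r, R < r → |deriv D r| ≤ C / r ^ 2 := by
  obtain ⟨C, hC, h⟩ := hD.asymptotics 1 (by norm_num)
  have hR := hD.R_pos
  have hM := hD.M_nonneg
  refine ⟨2 * M + C * R ^ (-β), by positivity, fun r hr => ?_⟩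
  have h0 := h r hr.le
  have hr0 : 0 < r := hR.trans hr
  have hd : HasDerivAt (fun r => D r - (1 - 2 * M / r)) (deriv D r - 2 * M / r ^ 2) r := by
    refine ((hD.hasDerivAt hr).sub ((hasDerivAt_const r (1 : ℝ)).sub
      ((hasDerivAt_inv hr0.ne').const_mul (2 * M)))).congr_deriv ?_
    field_simp
    ring
  rw [iteratedDerivWithin_one, derivWithin_of_mem_nhds (Ici_mem_nhds hr), hd.deriv] at h0
  have h1 : r ^ (-(1 + β) - ((1 : ℕ) : ℝ)) = r ^ (-β) / r ^ 2 := by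
    rw [show -(1 + β) - ((1 : ℕ) : ℝ) = -β - 2 by push_cast; ring, Real.rpow_sub hr0]
    norm_num
  rw [h1] at h0
  have h2 : r ^ (-β) ≤ R ^ (-β) :=
    Real.rpow_le_rpow_of_nonpos hR hr.le (by linarith [hD.β_pos])
  have h3 : C * (r ^ (-β) / r ^ 2) ≤ C * (R ^ (-β) / r ^ 2) := by gcongr
  have h4 : 0 ≤ 2 * M / r ^ 2 := by positivity
  have h5 : (2 * M + C * R ^ (-β)) / r ^ 2 = 2 * M / r ^ 2 + C * (R ^ (-β) / r ^ 2) := by ring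
  rw [h5]
  rw [abs_le] at h0 ⊢
  constructor <;> linarith [h0.1, h0.2]

end MetricCoefficient

/-- The properties of the metric coefficient `D` on `r > R` used for spherically symmetric waves;
`D'` is its derivative. -/
structure IsFlatCoefficient (R K C : ℝ) (D D' : ℝ → ℝ) : Prop where
  R_pos : 0 < R
  K_pos : 0 < K
  C_pos : 0 < C
  hasDerivAt : ∀ r, R < r → HasDerivAt D (D' r) r
  continuousOn_deriv : ContinuousOn D' (Ioi R)
  nonneg : ∀ r, R < r → 0 ≤ D r
  le : ∀ r, R < r → D r ≤ K
  abs_deriv_le : ∀ r, R < r → |D' r| ≤ C / r ^ 2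

theorem IsFlatCoefficient.continuousOn {R K C : ℝ} {D D' : ℝ → ℝ}
    (hD : IsFlatCoefficient R K C D D') : ContinuousOn D (Ioi R) :=
  fun r hr => (hD.hasDerivAt r hr).continuousAt.continuousWithinAt

/-! ### The `r²`-weighted energy estimate on bounded ranges of `u`. -/

section Energy

variable {R K C : ℝ} {D D' : ℝ → ℝ} {φ Φ Φr : ℝ → ℝ → ℝ}

theorem IsSphericalWave.sub_eq_integral (hw : IsSphericalWave R D D' φ Φ Φr) {u a r : ℝ}
    (hu : 0 ≤ u) (ha : R < a) (har : a ≤ r) : φ u r - φ u a = ∫ s in a..r, Φ u s := by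
  symm
  refine intervalIntegral.integral_eq_sub_of_hasDerivAt (fun s hs => ?_)
    (ContinuousOn.intervalIntegrable ?_)
  · rw [uIcc_of_le har] at hs
    exact hw.hasDerivAt_field u s hu (ha.trans_le hs.1)
  · rw [uIcc_of_le har]
    exact (continuousOn_slice_right hw.continuousOn_dr hu).mono fun s hs => ha.trans_le hs.1

/-- The `r²`-weighted energy, cut off smoothly along the line `r + K u = V`. -/
def cutoffEnergy (K V a : ℝ) (Φ : ℝ → ℝ → ℝ) (u : ℝ) : ℝ :=
  ∫ r in a..V, Real.smoothTransition (V - r - K * u) * (r ^ 2 * Φ u r ^ 2)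

theorem hasDerivAt_smoothTransition (x : ℝ) :
    HasDerivAt Real.smoothTransition (deriv Real.smoothTransition x) x :=
  ((Real.smoothTransition.contDiff (n := 1)).differentiable (by simp) x).hasDerivAt

theorem continuous_deriv_smoothTransition : Continuous (deriv Real.smoothTransition) :=
  (Real.smoothTransition.contDiff (n := 1)).continuous_deriv (by simp)

theorem IsSphericalWave.continuousOn_cutoffEnergy (hw : IsSphericalWave R D D' φ Φ Φr)
    {a V : ℝ} (ha : R < a) (haV : a ≤ V) : ContinuousOn (cutoffEnergy K V a Φ) (Ici 0) := by
  refine continuousOn_intervalIntegral_param (f := fun u r =>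
    Real.smoothTransition (V - r - K * u) * (r ^ 2 * Φ u r ^ 2)) haV ?_
  have h1 : ContinuousOn (fun p : ℝ × ℝ => Φ p.1 p.2) (Ici 0 ×ˢ Icc a V) :=
    hw.continuousOn_dr.mono (prod_mono subset_rfl fun s hs => ha.trans_le hs.1)
  have h2 : Continuous (fun p : ℝ × ℝ => Real.smoothTransition (V - p.2 - K * p.1)) :=
    Real.smoothTransition.continuous.comp (by fun_prop)
  change ContinuousOn (fun p : ℝ × ℝ =>
    Real.smoothTransition (V - p.2 - K * p.1) * (p.2 ^ 2 * Φ p.1 p.2 ^ 2)) _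
  fun_prop

theorem IsSphericalWave.hasDerivAt_cutoffEnergy (hD : IsFlatCoefficient R K C D D')
    (hw : IsSphericalWave R D D' φ Φ Φr) {a V u : ℝ} (ha : R < a) (haV : a ≤ V) (hu : 0 < u) :
    HasDerivAt (cutoffEnergy K V a Φ)
      (∫ r in a..V, (-(K * deriv Real.smoothTransition (V - r - K * u)) * (r ^ 2 * Φ u r ^ 2) +
        Real.smoothTransition (V - r - K * u) *
          (r ^ 2 * (Φ u r * (D r * Φr u r + D' r * Φ u r - D' r / r * φ u r))))) u := by
  have hsub : Ioi (0 : ℝ) ×ˢ Icc a V ⊆ Ici 0 ×ˢ Ioi R :=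
    prod_mono Ioi_subset_Ici_self fun s hs => ha.trans_le hs.1
  refine hasDerivAt_intervalIntegral_param (f := fun u r =>
    Real.smoothTransition (V - r - K * u) * (r ^ 2 * Φ u r ^ 2)) (f' := fun u r =>
    -(K * deriv Real.smoothTransition (V - r - K * u)) * (r ^ 2 * Φ u r ^ 2) +
        Real.smoothTransition (V - r - K * u) *
          (r ^ 2 * (Φ u r * (D r * Φr u r + D' r * Φ u r - D' r / r * φ u r))))
    haV (Ioi_mem_nhds hu) ?_ ?_ ?_
  · intro s hs
    have h1 : ContinuousOn (Φ s) (Icc a V) :=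
      (continuousOn_slice_right hw.continuousOn_dr (mem_Ici.2 (le_of_lt hs))).mono
        fun r hr => ha.trans_le hr.1
    have h2 : Continuous (fun r : ℝ => Real.smoothTransition (V - r - K * s)) :=
      Real.smoothTransition.continuous.comp (by fun_prop)
    fun_prop
  · have h1 : ContinuousOn (fun p : ℝ × ℝ => Φ p.1 p.2) (Ioi 0 ×ˢ Icc a V) :=
      hw.continuousOn_dr.mono hsub
    have h2 : ContinuousOn (fun p : ℝ × ℝ => φ p.1 p.2) (Ioi 0 ×ˢ Icc a V) :=
      hw.continuousOn_field.mono hsub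
    have h3 : ContinuousOn (fun p : ℝ × ℝ => Φr p.1 p.2) (Ioi 0 ×ˢ Icc a V) :=
      hw.continuousOn_drr.mono hsub
    have h4 : Continuous (fun p : ℝ × ℝ => Real.smoothTransition (V - p.2 - K * p.1)) :=
      Real.smoothTransition.continuous.comp (by fun_prop)
    have h5 : Continuous (fun p : ℝ × ℝ => deriv Real.smoothTransition (V - p.2 - K * p.1)) :=
      continuous_deriv_smoothTransition.comp (by fun_prop)
    have h6 : ContinuousOn (fun p : ℝ × ℝ => D p.2) (Ioi 0 ×ˢ Icc a V) :=
      hD.continuousOn.comp (by fun_prop) fun p hp => (hsub hp).2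
    have h7 : ContinuousOn (fun p : ℝ × ℝ => D' p.2) (Ioi 0 ×ˢ Icc a V) :=
      hD.continuousOn_deriv.comp (by fun_prop) fun p hp => (hsub hp).2
    have h8 : ContinuousOn (fun p : ℝ × ℝ => D' p.2 / p.2) (Ioi 0 ×ˢ Icc a V) :=
      h7.div continuousOn_snd fun p hp => (hD.R_pos.trans (hsub hp).2).ne'
    change ContinuousOn (fun p : ℝ × ℝ =>
      -(K * deriv Real.smoothTransition (V - p.2 - K * p.1)) * (p.2 ^ 2 * Φ p.1 p.2 ^ 2) +
        Real.smoothTransition (V - p.2 - K * p.1) * (p.2 ^ 2 * (Φ p.1 p.2 *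
          (D p.2 * Φr p.1 p.2 + D' p.2 * Φ p.1 p.2 - D' p.2 / p.2 * φ p.1 p.2)))) _
    exact ContinuousOn.add (by fun_prop) (h4.continuousOn.mul ((continuousOn_snd.pow 2).mul
      (h1.mul (((h6.mul h3).add (h7.mul h1)).sub (h8.mul h2)))))
  · intro s hs r hr
    have h1 := hw.evolution s r hs (ha.trans_le hr.1)
    have h2 : HasDerivAt (fun s => V - r - K * s) (-(K * 1)) s :=
      ((hasDerivAt_id' s).const_mul K).const_sub (V - r)
    have h3 := (hasDerivAt_smoothTransition (V - r - K * s)).comp s h2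
    refine (h3.mul ((h1.pow 2).const_mul (r ^ 2))).congr_deriv ?_
    simp only [Pi.pow_apply, Function.comp_apply]
    push_cast
    ring

/-- The pointwise bound on the energy density production, up to an exact derivative. -/
theorem energy_density_le (hD : IsFlatCoefficient R K C D D') {a r z z' F f fr Y : ℝ}
    (ha : R < a) (har : a ≤ r) (hz : 0 ≤ z) (hz' : 0 ≤ z') (hY : z * f ^ 2 ≤ Y) :
    -(K * z') * (r ^ 2 * F ^ 2) + z * (r ^ 2 * (F * (D r * fr + D' r * F - D' r / r * f))) ≤
      (-z' * (r ^ 2 * D r * F ^ 2 / 2) +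
        z * ((2 * r * D r + r ^ 2 * D' r) * F ^ 2 / 2 + r ^ 2 * D r * (F * fr))) +
      (C / (2 * a ^ 2) + C / 2) * (z * (r ^ 2 * F ^ 2)) + C / 2 * a⁻¹ ^ 2 * Y * (r ^ 2)⁻¹ := by
  have hr : R < r := ha.trans_le har
  have ha0 : 0 < a := hD.R_pos.trans ha
  have hr0 : 0 < r := hD.R_pos.trans hr
  have hDn := hD.nonneg r hr
  have hDK := hD.le r hr
  have hD' := hD.abs_deriv_le r hr
  have hC := hD.C_pos
  -- Ingoing characteristics have `dr/du = -D / 2`. The cutoff line moves inwards at speed `K ≥ D /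
  -- 2`, so no energy enters through it.
  have h1 : 0 ≤ (K - D r / 2) * (z' * (r ^ 2 * F ^ 2)) :=
    mul_nonneg (by linarith) (by positivity)
  -- Differentiating the weight `r²` produces a term of favourable sign, which is dropped.
  have h2 : 0 ≤ z * (r * D r * F ^ 2) := by positivity
  have h3 : z * (r ^ 2 * D' r * F ^ 2 / 2) ≤ C / (2 * a ^ 2) * (z * (r ^ 2 * F ^ 2)) := by
    have e1 : D' r ≤ C / a ^ 2 := (le_abs_self _).trans (hD'.trans (by gcongr))
    have e2 : z * (r ^ 2 * D' r * F ^ 2 / 2) = D' r * (z * (r ^ 2 * F ^ 2) / 2) := by ring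
    have e3 : C / (2 * a ^ 2) * (z * (r ^ 2 * F ^ 2)) = C / a ^ 2 * (z * (r ^ 2 * F ^ 2) / 2) := by
      field_simp
    rw [e2, e3]
    exact mul_le_mul_of_nonneg_right e1 (by positivity)
  -- Young's inequality puts `r⁻⁴` on the `f²` term: one `r⁻²` is kept for the integration in `r`,
  -- the other is bounded by `a⁻²`.
  have h4 : -(z * (r * D' r * (F * f))) ≤
      C / 2 * (z * (r ^ 2 * F ^ 2)) + C / 2 * a⁻¹ ^ 2 * Y * (r ^ 2)⁻¹ := by
    have e1 : -(z * (r * D' r * (F * f))) ≤ |D' r| * (z * r * (|F| * |f|)) := by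
      calc -(z * (r * D' r * (F * f))) ≤ |-(z * (r * D' r * (F * f)))| := le_abs_self _
        _ = |D' r| * (z * r * (|F| * |f|)) := by
            rw [abs_neg, abs_mul, abs_mul, abs_mul, abs_mul, abs_of_nonneg hz, abs_of_pos hr0]
            ring
    have e2 : |D' r| * (z * r * (|F| * |f|)) ≤ C / r ^ 2 * (z * r * (|F| * |f|)) :=
      mul_le_mul_of_nonneg_right hD' (by positivity)
    have e3 : C / r ^ 2 * (z * r * (|F| * |f|)) ≤
        C / 2 * (z * (r ^ 2 * F ^ 2)) + C / 2 * (z * f ^ 2) * (r ^ 4)⁻¹ := by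
      have e4 : 0 ≤ C * z / 2 * (r * |F| - |f| * (r ^ 2)⁻¹) ^ 2 := by positivity
      have e5 : C * z / 2 * (r * |F| - |f| * (r ^ 2)⁻¹) ^ 2 =
          C / 2 * (z * (r ^ 2 * |F| ^ 2)) + C / 2 * (z * |f| ^ 2) * (r ^ 4)⁻¹ -
            C / r ^ 2 * (z * r * (|F| * |f|)) := by
        field_simp
        ring
      rw [sq_abs, sq_abs] at e5
      linarith
    have e6 : C / 2 * (z * f ^ 2) * (r ^ 4)⁻¹ ≤ C / 2 * a⁻¹ ^ 2 * Y * (r ^ 2)⁻¹ := by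
      have e7 : (r ^ 4)⁻¹ ≤ a⁻¹ ^ 2 * (r ^ 2)⁻¹ := by
        have : (r ^ 4)⁻¹ = r⁻¹ ^ 2 * (r ^ 2)⁻¹ := by field_simp
        rw [this]
        gcongr
      have hY0 : 0 ≤ Y := le_trans (by positivity) hY
      calc C / 2 * (z * f ^ 2) * (r ^ 4)⁻¹ ≤ C / 2 * Y * (a⁻¹ ^ 2 * (r ^ 2)⁻¹) := by gcongr
        _ = _ := by ring
    linarith
  have hid : r ^ 2 * (F * (D r * fr + D' r * F - D' r / r * f)) =
      r ^ 2 * D r * (F * fr) + r ^ 2 * D' r * F ^ 2 - r * D' r * (F * f) := by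
    field_simp
  rw [hid]
  linarith

end Energy

section Energy

variable {R K C : ℝ} {D D' : ℝ → ℝ} {φ Φ Φr : ℝ → ℝ → ℝ}

/-- The field is recovered from its value at `r = a` and the integral of `Φ`. As the cutoff
decreases in `r`, its value at the endpoint can be moved inside that integral. -/
theorem IsSphericalWave.cutoff_mul_sq_le (hD : IsFlatCoefficient R K C D D')
    (hw : IsSphericalWave R D D' φ Φ Φr) {a V u B r : ℝ} (ha : R < a) (hu : 0 ≤ u)
    (hB : |φ u a| ≤ B) (hr : r ∈ Icc a V) :
    Real.smoothTransition (V - r - K * u) * φ u r ^ 2 ≤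
      2 * B ^ 2 + 8 * a⁻¹ * cutoffEnergy K V a Φ u := by
  have ha0 : 0 < a := hD.R_pos.trans ha
  have hΦ : ContinuousOn (Φ u) (Icc a V) :=
    (continuousOn_slice_right hw.continuousOn_dr hu).mono fun s hs => ha.trans_le hs.1
  have hΦr : ContinuousOn (Φ u) (Icc a r) := hΦ.mono (Icc_subset_Icc_right hr.2)
  have hz : Continuous (fun s : ℝ => Real.smoothTransition (V - s - K * u)) :=
    Real.smoothTransition.continuous.comp (by fun_prop)
  have h1 := hw.sub_eq_integral hu ha hr.1
  have h2 := sq_integral_le ha0 hr.1 hΦr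
  rw [← h1] at h2
  have hz0 := Real.smoothTransition.nonneg (V - r - K * u)
  have hz1 := Real.smoothTransition.le_one (V - r - K * u)
  have h3 : Real.smoothTransition (V - r - K * u) * ∫ s in a..r, s ^ 2 * Φ u s ^ 2 ≤
      cutoffEnergy K V a Φ u := by
    have hi : IntervalIntegrable (fun s => Real.smoothTransition (V - s - K * u) *
        (s ^ 2 * Φ u s ^ 2)) volume a V := ContinuousOn.intervalIntegrable (by
      rw [uIcc_of_le (hr.1.trans hr.2)]; fun_prop)
    calc Real.smoothTransition (V - r - K * u) * ∫ s in a..r, s ^ 2 * Φ u s ^ 2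
        = ∫ s in a..r, Real.smoothTransition (V - r - K * u) * (s ^ 2 * Φ u s ^ 2) := by
          rw [intervalIntegral.integral_const_mul]
      _ ≤ ∫ s in a..r, Real.smoothTransition (V - s - K * u) * (s ^ 2 * Φ u s ^ 2) := by
          refine intervalIntegral.integral_mono_on hr.1 (ContinuousOn.intervalIntegrable ?_)
            (ContinuousOn.intervalIntegrable ?_) fun s hs => ?_
          · rw [uIcc_of_le hr.1]; fun_prop
          · rw [uIcc_of_le hr.1]; fun_prop
          · exact mul_le_mul_of_nonneg_right
              (Real.smoothTransition.monotone (by linarith [hs.2])) (by positivity)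
      _ ≤ cutoffEnergy K V a Φ u := by
          refine intervalIntegral.integral_mono_interval le_rfl hr.1 hr.2 ?_ hi
          exact Eventually.of_forall fun s =>
            mul_nonneg (Real.smoothTransition.nonneg _) (by positivity)
  have h4 : φ u r ^ 2 ≤ 2 * φ u a ^ 2 + 2 * (φ u r - φ u a) ^ 2 := by
    nlinarith [sq_nonneg (φ u r - 2 * φ u a)]
  have h5 : φ u a ^ 2 ≤ B ^ 2 := by
    rw [← sq_abs (φ u a)]
    gcongr
  calc Real.smoothTransition (V - r - K * u) * φ u r ^ 2
      ≤ Real.smoothTransition (V - r - K * u) *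
        (2 * B ^ 2 + 2 * (4 * a⁻¹ * ∫ s in a..r, s ^ 2 * Φ u s ^ 2)) := by
        gcongr; linarith
    _ = Real.smoothTransition (V - r - K * u) * (2 * B ^ 2) + 8 * a⁻¹ *
        (Real.smoothTransition (V - r - K * u) * ∫ s in a..r, s ^ 2 * Φ u s ^ 2) := by ring
    _ ≤ 1 * (2 * B ^ 2) + 8 * a⁻¹ * cutoffEnergy K V a Φ u := by gcongr
    _ = _ := by ring

theorem IsSphericalWave.deriv_cutoffEnergy_le (hD : IsFlatCoefficient R K C D D')
    (hw : IsSphericalWave R D D' φ Φ Φr) {a V u B : ℝ} (ha : R < a) (haV : a ≤ V) (hu : 0 < u)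
    (hB : |φ u a| ≤ B) :
    deriv (cutoffEnergy K V a Φ) u ≤
      (C / (2 * a ^ 2) + C / 2 + 4 * C * a⁻¹ ^ 4) * cutoffEnergy K V a Φ u +
        C * B ^ 2 * a⁻¹ ^ 3 := by
  have ha0 : 0 < a := hD.R_pos.trans ha
  have hsub : Icc a V ⊆ Ioi R := fun s hs => ha.trans_le hs.1
  have hΦ : ContinuousOn (Φ u) (Icc a V) :=
    (continuousOn_slice_right hw.continuousOn_dr hu.le).mono hsub
  have hφ : ContinuousOn (φ u) (Icc a V) :=
    (continuousOn_slice_right hw.continuousOn_field hu.le).mono hsub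
  have hΦr : ContinuousOn (Φr u) (Icc a V) :=
    (continuousOn_slice_right hw.continuousOn_drr hu.le).mono hsub
  have hDc : ContinuousOn D (Icc a V) := hD.continuousOn.mono hsub
  have hD'c : ContinuousOn D' (Icc a V) := hD.continuousOn_deriv.mono hsub
  have hD'r : ContinuousOn (fun r => D' r / r) (Icc a V) :=
    hD'c.div continuousOn_id fun r hr => (hD.R_pos.trans (hsub hr)).ne'
  have hz : Continuous (fun r : ℝ => Real.smoothTransition (V - r - K * u)) :=
    Real.smoothTransition.continuous.comp (by fun_prop)
  have hz' : Continuous (fun r : ℝ => deriv Real.smoothTransition (V - r - K * u)) :=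
    continuous_deriv_smoothTransition.comp (by fun_prop)
  set e := cutoffEnergy K V a Φ u with he
  set Y := 2 * B ^ 2 + 8 * a⁻¹ * e with hY
  have hint : ∀ {f : ℝ → ℝ}, ContinuousOn f (Icc a V) → IntervalIntegrable f volume a V :=
    fun hf => ContinuousOn.intervalIntegrable (by rwa [uIcc_of_le haV])
  have hi1 := hint (f := fun r => -deriv Real.smoothTransition (V - r - K * u) *
      (r ^ 2 * D r * Φ u r ^ 2 / 2) + Real.smoothTransition (V - r - K * u) *
      ((2 * r * D r + r ^ 2 * D' r) * Φ u r ^ 2 / 2 + r ^ 2 * D r * (Φ u r * Φr u r)))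
      (by fun_prop)
  have hi2 := hint (f := fun r => Real.smoothTransition (V - r - K * u) * (r ^ 2 * Φ u r ^ 2))
      (by fun_prop)
  have hi3 := hint (f := fun r : ℝ => (r ^ 2)⁻¹) (continuousOn_inv_sq ha0)
  rw [(hw.hasDerivAt_cutoffEnergy hD ha haV hu).deriv]
  have hY0 : 0 ≤ Y := by
    have : 0 ≤ e := intervalIntegral.integral_nonneg haV fun r _ =>
      mul_nonneg (Real.smoothTransition.nonneg _) (by positivity)
    positivity
  have hmono := intervalIntegral.integral_mono_on haV
    (hint (ContinuousOn.add (by fun_prop) (hz.continuousOn.mul ((continuousOn_id.pow 2).mul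
      (hΦ.mul (((hDc.mul hΦr).add (hD'c.mul hΦ)).sub (hD'r.mul hφ)))))))
    ((hi1.add (hi2.const_mul (C / (2 * a ^ 2) + C / 2))).add
      (hi3.const_mul (C / 2 * a⁻¹ ^ 2 * Y)))
    fun r hr => energy_density_le hD (fr := Φr u r) (F := Φ u r) ha hr.1
      (Real.smoothTransition.nonneg (V - r - K * u))
      (Real.smoothTransition.monotone.deriv_nonneg (x := V - r - K * u))
      (hw.cutoff_mul_sq_le hD ha hu.le hB hr)
  refine (le_trans hmono ?_)
  -- The exact derivative integrates to boundary values: the cutoff vanishes at `r = V`, and at `r =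
  -- a` the flux leaves the region.
  have hflux : ∫ r in a..V, (-deriv Real.smoothTransition (V - r - K * u) *
      (r ^ 2 * D r * Φ u r ^ 2 / 2) + Real.smoothTransition (V - r - K * u) *
      ((2 * r * D r + r ^ 2 * D' r) * Φ u r ^ 2 / 2 + r ^ 2 * D r * (Φ u r * Φr u r))) ≤ 0 := by
    have hd : ∀ r ∈ uIcc a V, HasDerivAt (fun r => Real.smoothTransition (V - r - K * u) *
        (r ^ 2 * D r * Φ u r ^ 2 / 2)) (-deriv Real.smoothTransition (V - r - K * u) *
      (r ^ 2 * D r * Φ u r ^ 2 / 2) + Real.smoothTransition (V - r - K * u) *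
      ((2 * r * D r + r ^ 2 * D' r) * Φ u r ^ 2 / 2 + r ^ 2 * D r * (Φ u r * Φr u r))) r := by
      intro r hr
      rw [uIcc_of_le haV] at hr
      have h2 : HasDerivAt (fun r => V - r - K * u) (-1) r :=
        ((hasDerivAt_id' r).const_sub V).sub_const (K * u)
      have h3 := (hasDerivAt_smoothTransition (V - r - K * u)).comp r h2
      refine (h3.mul (((((hasDerivAt_id' r).pow 2).mul (hD.hasDerivAt r (hsub hr))).mul
        ((hw.hasDerivAt_dr u r hu.le (hsub hr)).pow 2)).div_const 2)).congr_deriv ?_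
      simp only [Pi.pow_apply, Pi.mul_apply, Function.comp_apply]
      push_cast
      ring
    rw [intervalIntegral.integral_eq_sub_of_hasDerivAt hd hi1,
      Real.smoothTransition.zero_of_nonpos
        (by linarith [mul_pos hD.K_pos hu] : V - V - K * u ≤ 0)]
    have := mul_nonneg (Real.smoothTransition.nonneg (V - a - K * u))
      (by have := hD.nonneg a ha; positivity : 0 ≤ a ^ 2 * D a * Φ u a ^ 2 / 2)
    linarith
  rw [intervalIntegral.integral_add (hi1.add (hi2.const_mul _)) (hi3.const_mul _),
    intervalIntegral.integral_add hi1 (hi2.const_mul _), intervalIntegral.integral_const_mul,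
    intervalIntegral.integral_const_mul, integral_inv_sq ha0 haV]
  change _ + _ * e + _ ≤ _
  have hC := hD.C_pos
  have h6 : C / 2 * a⁻¹ ^ 2 * Y * (a⁻¹ - V⁻¹) ≤ C / 2 * a⁻¹ ^ 2 * Y * a⁻¹ := by
    have : 0 < V⁻¹ := inv_pos.2 (ha0.trans_le haV)
    gcongr
    linarith
  have h7 : C / 2 * a⁻¹ ^ 2 * Y * a⁻¹ = 4 * C * a⁻¹ ^ 4 * e + C * B ^ 2 * a⁻¹ ^ 3 := by
    rw [hY]; ring
  linarith

/-- On a bounded range of `u`, the `r²`-weighted energy is bounded by that of the initial data. -/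
theorem IsSphericalWave.exists_integral_le (hD : IsFlatCoefficient R K C D D')
    (hw : IsSphericalWave R D D' φ Φ Φr) {a N : ℝ} (ha : R < a)
    (hN : ∀ r, a ≤ r → r ^ 2 * |Φ 0 r| ≤ N) (U : ℝ) :
    ∃ A : ℝ, ∀ u ∈ Icc 0 U, ∀ W, a ≤ W → ∫ r in a..W, r ^ 2 * Φ u r ^ 2 ≤ A := by
  have ha0 : 0 < a := hD.R_pos.trans ha
  have hC := hD.C_pos
  have hbc : ContinuousOn (fun u => φ u a) (Icc 0 U) :=
    hw.continuousOn_field.comp (f := fun u : ℝ => (u, a)) (by fun_prop) fun u hu => ⟨hu.1, ha⟩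
  obtain ⟨B, hB⟩ := isCompact_Icc.exists_bound_of_continuousOn hbc
  set C₁ := C / (2 * a ^ 2) + C / 2 + 4 * C * a⁻¹ ^ 4 with hC₁
  set C₂ := C * B ^ 2 * a⁻¹ ^ 3 with hC₂
  have hC₁0 : 0 < C₁ := by positivity
  have hN0 : 0 ≤ N := le_trans (by positivity) (hN a le_rfl)
  refine ⟨Real.exp (C₁ * U) * (N ^ 2 * a⁻¹ + C₂ / C₁), fun u hu W hW => ?_⟩
  have hU : 0 ≤ U := hu.1.trans hu.2
  -- With this `V` the cutoff equals 1 on `[a, W]` for every `u ≤ U`, while the constants of the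
  -- estimate do not depend on `V`.
  set V := W + 1 + K * U with hV
  have hKU : 0 ≤ K * U := mul_nonneg hD.K_pos.le hU
  have haV : a ≤ V := by linarith
  have hsub : Icc a V ⊆ Ioi R := fun s hs => ha.trans_le hs.1
  set e := cutoffEnergy K V a Φ with he
  have hec : ContinuousOn e (Icc 0 U) :=
    (hw.continuousOn_cutoffEnergy ha haV).mono Icc_subset_Ici_self
  have hed : ∀ s, 0 < s → HasDerivAt e (deriv e s) s := fun s hs =>
    (hw.hasDerivAt_cutoffEnergy hD ha haV hs).differentiableAt.hasDerivAt
  -- Grönwall's argument: the shift by `C₂ / C₁` makes the differential inequality homogeneous.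
  have hd : ∀ s, 0 < s → HasDerivAt (fun s => Real.exp (-(C₁ * s)) * (e s + C₂ / C₁))
      (Real.exp (-(C₁ * s)) * (deriv e s - (C₁ * e s + C₂))) s := by
    intro s hs
    have h1 : HasDerivAt (fun s => -(C₁ * s)) (-(C₁ * 1)) s :=
      ((hasDerivAt_id' s).const_mul C₁).neg
    refine (h1.exp.mul ((hed s hs).add_const (C₂ / C₁))).congr_deriv ?_
    field_simp
    ring
  have hanti : AntitoneOn (fun s => Real.exp (-(C₁ * s)) * (e s + C₂ / C₁)) (Icc 0 U) := by
    refine antitoneOn_of_deriv_nonpos (convex_Icc 0 U) (by fun_prop) ?_ ?_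
    · intro s hs
      rw [interior_Icc] at hs
      exact (hd s hs.1).differentiableAt.differentiableWithinAt
    · intro s hs
      rw [interior_Icc] at hs
      rw [(hd s hs.1).deriv]
      have : deriv e s ≤ C₁ * e s + C₂ := hw.deriv_cutoffEnergy_le hD ha haV hs.1 (hB s ⟨hs.1.le, hs.2.le⟩)
      exact mul_nonpos_of_nonneg_of_nonpos (Real.exp_pos _).le (by linarith)
  have h0 : e 0 ≤ N ^ 2 * a⁻¹ := by
    have hΦ : ContinuousOn (Φ 0) (Icc a V) :=
      (continuousOn_slice_right hw.continuousOn_dr (mem_Ici.2 le_rfl)).mono hsub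
    have hz : Continuous (fun r : ℝ => Real.smoothTransition (V - r - K * 0)) :=
      Real.smoothTransition.continuous.comp (by fun_prop)
    have : e 0 ≤ ∫ r in a..V, N ^ 2 * (r ^ 2)⁻¹ := by
      refine intervalIntegral.integral_mono_on haV (ContinuousOn.intervalIntegrable ?_)
        (ContinuousOn.intervalIntegrable ?_) fun r hr => ?_
      · rw [uIcc_of_le haV]; fun_prop
      · rw [uIcc_of_le haV]; exact continuousOn_const.mul (continuousOn_inv_sq ha0)
      · have hr0 : 0 < r := ha0.trans_le hr.1
        have h2 := hN r hr.1
        have h3 : (r ^ 2 * |Φ 0 r|) ^ 2 ≤ N ^ 2 := by gcongr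
        have h4 : r ^ 2 * Φ 0 r ^ 2 ≤ N ^ 2 * (r ^ 2)⁻¹ := by
          rw [mul_pow, sq_abs] at h3
          rw [← div_eq_mul_inv, le_div_iff₀ (by positivity)]
          linarith
        have h5 : Real.smoothTransition (V - r - K * 0) * (r ^ 2 * Φ 0 r ^ 2) ≤
            1 * (r ^ 2 * Φ 0 r ^ 2) := by
          gcongr
          exact Real.smoothTransition.le_one _
        linarith
    rw [intervalIntegral.integral_const_mul, integral_inv_sq ha0 haV] at this
    have hVi : 0 < V⁻¹ := inv_pos.2 (ha0.trans_le haV)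
    have : N ^ 2 * (a⁻¹ - V⁻¹) ≤ N ^ 2 * a⁻¹ := by gcongr; linarith
    linarith
  have h1 := hanti ⟨le_rfl, hU⟩ hu hu.1
  simp only [mul_zero, neg_zero, Real.exp_zero, one_mul] at h1
  have hC₂0 : 0 ≤ C₂ / C₁ := by positivity
  have h2 : e u ≤ Real.exp (C₁ * U) * (N ^ 2 * a⁻¹ + C₂ / C₁) := by
    have h3 : e u + C₂ / C₁ ≤ Real.exp (C₁ * u) * (N ^ 2 * a⁻¹ + C₂ / C₁) := by
      calc e u + C₂ / C₁ = Real.exp (C₁ * u) * (Real.exp (-(C₁ * u)) * (e u + C₂ / C₁)) := by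
            rw [← mul_assoc, ← Real.exp_add]; simp
        _ ≤ Real.exp (C₁ * u) * (N ^ 2 * a⁻¹ + C₂ / C₁) := by
            gcongr
            linarith
    have h4 : Real.exp (C₁ * u) ≤ Real.exp (C₁ * U) :=
      Real.exp_le_exp.2 (mul_le_mul_of_nonneg_left hu.2 hC₁0.le)
    have h5 : Real.exp (C₁ * u) * (N ^ 2 * a⁻¹ + C₂ / C₁) ≤
        Real.exp (C₁ * U) * (N ^ 2 * a⁻¹ + C₂ / C₁) :=
      mul_le_mul_of_nonneg_right h4 (by positivity)
    linarith
  refine le_trans ?_ h2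
  have hΦ : ContinuousOn (Φ u) (Icc a V) :=
    (continuousOn_slice_right hw.continuousOn_dr hu.1).mono hsub
  have hz : Continuous (fun r : ℝ => Real.smoothTransition (V - r - K * u)) :=
    Real.smoothTransition.continuous.comp (by fun_prop)
  have hWV : W ≤ V := by linarith
  calc ∫ r in a..W, r ^ 2 * Φ u r ^ 2
      = ∫ r in a..W, Real.smoothTransition (V - r - K * u) * (r ^ 2 * Φ u r ^ 2) := by
        refine intervalIntegral.integral_congr fun r hr => ?_
        rw [uIcc_of_le hW] at hr
        have : K * u ≤ K * U := mul_le_mul_of_nonneg_left hu.2 hD.K_pos.le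
        rw [Real.smoothTransition.one_of_one_le (by linarith [hr.2]), one_mul]
    _ ≤ e u := by
        refine intervalIntegral.integral_mono_interval le_rfl hW hWV
          (Eventually.of_forall fun s => mul_nonneg (Real.smoothTransition.nonneg _)
            (by positivity)) (ContinuousOn.intervalIntegrable ?_)
        rw [uIcc_of_le haV]; fun_prop

end Energy

/-! ### The equation tested against `(L - u) h(r)`. -/

/-- The weight `L - u` vanishes at `u = L`, so the initial value is the only boundary term and
nothing need be known about `f L`. -/
theorem integral_sub_mul_deriv {f f' : ℝ → ℝ} {L : ℝ} (hL : 0 ≤ L) (hf : ContinuousOn f (Ici 0))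
    (hf' : ContinuousOn f' (Ici 0)) (hd : ∀ u, 0 < u → HasDerivAt f (f' u) u) :
    ∫ u in (0 : ℝ)..L, (L - u) * f' u = -(L * f 0) + ∫ u in (0 : ℝ)..L, f u := by
  have hfc : ContinuousOn f (Icc 0 L) := hf.mono Icc_subset_Ici_self
  have hfc' : ContinuousOn f' (Icc 0 L) := hf'.mono Icc_subset_Ici_self
  have hi : ∀ {g : ℝ → ℝ}, ContinuousOn g (Icc 0 L) → IntervalIntegrable g volume 0 L :=
    fun hg => ContinuousOn.intervalIntegrable (by rwa [uIcc_of_le hL])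
  have h := intervalIntegral.integral_eq_sub_of_hasDerivAt_of_le hL
    (f := fun u => (L - u) * f u) (f' := fun u => (L - u) * f' u - f u) (by fun_prop)
    (fun u hu => (((hasDerivAt_id' u).const_sub L).mul (hd u hu.1)).congr_deriv (by ring))
    (hi (by fun_prop))
  rw [intervalIntegral.integral_sub (hi (by fun_prop)) (hi hfc)] at h
  simp only [sub_self, zero_mul, sub_zero, zero_sub] at h
  linarith

theorem abs_integral_le_of_abs_le {f g : ℝ → ℝ} {a b : ℝ} (hab : a ≤ b)
    (h : ∀ t ∈ Icc a b, |f t| ≤ g t) (hg : ContinuousOn g (Icc a b)) :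
    |∫ t in a..b, f t| ≤ ∫ t in a..b, g t := by
  rw [← Real.norm_eq_abs]
  exact intervalIntegral.norm_integral_le_of_norm_le hab
    (Eventually.of_forall fun t ht => h t (Ioc_subset_Icc_self ht))
    (ContinuousOn.intervalIntegrable (by rwa [uIcc_of_le hab]))

section Pairing

variable {R K C : ℝ} {D D' : ℝ → ℝ} {φ Φ Φr : ℝ → ℝ → ℝ}

theorem IsSphericalWave.continuousOn_pairing {f : ℝ → ℝ → ℝ}
    (hf : ContinuousOn (Function.uncurry f) (Ici 0 ×ˢ Ioi R)) {w : ℝ → ℝ}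
    (hwt : ContinuousOn w (Ioi R)) {c d : ℝ} (hc : R < c) (hcd : c ≤ d) :
    ContinuousOn (fun u => ∫ r in c..d, w r * f u r) (Ici 0) := by
  refine continuousOn_intervalIntegral_param (f := fun u r => w r * f u r) hcd ?_
  have hsub : Ici (0 : ℝ) ×ˢ Icc c d ⊆ Ici 0 ×ˢ Ioi R :=
    prod_mono subset_rfl fun s hs => hc.trans_le hs.1
  exact (hwt.comp continuousOn_snd fun p hp => (hsub hp).2).mul (hf.mono hsub)

/-- The weak form of the evolution equation, tested against a function of `r`. -/
theorem IsSphericalWave.hasDerivAt_pairing (hD : IsFlatCoefficient R K C D D')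
    (hw : IsSphericalWave R D D' φ Φ Φr) {c d u : ℝ} (hc : R < c) (hcd : c ≤ d) (hu : 0 < u)
    {h h' : ℝ → ℝ} (hh : ∀ r, HasDerivAt h (h' r) r) (hh' : Continuous h') (h0 : h c = 0)
    (h1 : h d = 0) :
    HasDerivAt (fun u => ∫ r in c..d, h r * Φ u r)
      (-(1 / 2) * ((∫ r in c..d, D r * h' r * Φ u r) + ∫ r in c..d, D' r / r * h r * φ u r)) u := by
  have hhc : Continuous h := continuous_iff_continuousAt.2 fun r => (hh r).continuousAt
  have hR : Icc c d ⊆ Ioi R := fun s hs => hc.trans_le hs.1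
  have hsub : Ioi (0 : ℝ) ×ˢ Icc c d ⊆ Ici 0 ×ˢ Ioi R := prod_mono Ioi_subset_Ici_self hR
  have hder := hasDerivAt_intervalIntegral_param (f := fun u r => h r * Φ u r)
    (f' := fun u r => h r * ((D r * Φr u r + D' r * Φ u r - D' r / r * φ u r) / 2))
    (x₀ := u) hcd (Ioi_mem_nhds hu)
    (fun s hs => hhc.continuousOn.mul
      ((continuousOn_slice_right hw.continuousOn_dr (mem_Ici.2 (le_of_lt hs))).mono hR))
    (by
      have e1 : ContinuousOn (fun p : ℝ × ℝ => Φ p.1 p.2) (Ioi 0 ×ˢ Icc c d) :=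
        hw.continuousOn_dr.mono hsub
      have e2 : ContinuousOn (fun p : ℝ × ℝ => φ p.1 p.2) (Ioi 0 ×ˢ Icc c d) :=
        hw.continuousOn_field.mono hsub
      have e3 : ContinuousOn (fun p : ℝ × ℝ => Φr p.1 p.2) (Ioi 0 ×ˢ Icc c d) :=
        hw.continuousOn_drr.mono hsub
      have e6 : ContinuousOn (fun p : ℝ × ℝ => D p.2) (Ioi 0 ×ˢ Icc c d) :=
        hD.continuousOn.comp (by fun_prop) fun p hp => (hsub hp).2
      have e7 : ContinuousOn (fun p : ℝ × ℝ => D' p.2) (Ioi 0 ×ˢ Icc c d) :=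
        hD.continuousOn_deriv.comp (by fun_prop) fun p hp => (hsub hp).2
      have e8 : ContinuousOn (fun p : ℝ × ℝ => D' p.2 / p.2) (Ioi 0 ×ˢ Icc c d) :=
        e7.div continuousOn_snd fun p hp => (hD.R_pos.trans (hsub hp).2).ne'
      exact (hhc.comp continuous_snd).continuousOn.mul
        ((((e6.mul e3).add (e7.mul e1)).sub (e8.mul e2)).div_const 2))
    (fun s hs r hr => (hw.evolution s r hs (hR hr)).const_mul (h r))
  refine hder.congr_deriv ?_
  have hΦ : ContinuousOn (Φ u) (Icc c d) :=
    (continuousOn_slice_right hw.continuousOn_dr hu.le).mono hR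
  have hφ : ContinuousOn (φ u) (Icc c d) :=
    (continuousOn_slice_right hw.continuousOn_field hu.le).mono hR
  have hΦr : ContinuousOn (Φr u) (Icc c d) :=
    (continuousOn_slice_right hw.continuousOn_drr hu.le).mono hR
  have hDc : ContinuousOn D (Icc c d) := hD.continuousOn.mono hR
  have hD'c : ContinuousOn D' (Icc c d) := hD.continuousOn_deriv.mono hR
  have hD'r : ContinuousOn (fun r => D' r / r) (Icc c d) :=
    hD'c.div continuousOn_id fun r hr => (hD.R_pos.trans (hR hr)).ne'
  have hi : ∀ {g : ℝ → ℝ}, ContinuousOn g (Icc c d) → IntervalIntegrable g volume c d :=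
    fun hg => ContinuousOn.intervalIntegrable (by rwa [uIcc_of_le hcd])
  have i1 := hi (g := fun r => h' r * (D r * Φ u r) + h r * (D' r * Φ u r + D r * Φr u r))
    (by fun_prop)
  have i2 := hi (g := fun r => D r * h' r * Φ u r) (by fun_prop)
  have i3 : IntervalIntegrable (fun r => D' r / r * h r * φ u r) volume c d :=
    hi ((hD'r.mul hhc.continuousOn).mul hφ)
  -- The integral of `(h D Φ)'` is zero as `h` vanishes at both ends; subtracting it eliminates
  -- `Φr`.
  have hz : ∫ r in c..d, (h' r * (D r * Φ u r) + h r * (D' r * Φ u r + D r * Φr u r)) = 0 := by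
    rw [intervalIntegral.integral_eq_sub_of_hasDerivAt (f := fun r => h r * (D r * Φ u r)) _ i1]
    · rw [h0, h1]; ring
    · intro r hr
      rw [uIcc_of_le hcd] at hr
      exact (hh r).mul ((hD.hasDerivAt r (hR hr)).mul (hw.hasDerivAt_dr u r hu.le (hR hr)))
  rw [← sub_zero (_ + _), ← hz, ← intervalIntegral.integral_add i2 i3,
    ← intervalIntegral.integral_sub (i2.add i3) i1, ← intervalIntegral.integral_const_mul]
  refine intervalIntegral.integral_congr fun r _ => ?_
  ring

/-- Pairing the equation on `[0, L] × [c, d]` with `(L - u) h(r)`. -/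
theorem IsSphericalWave.abs_pairing_sub_le (hD : IsFlatCoefficient R K C D D')
    (hw : IsSphericalWave R D D' φ Φ Φr) {a c d L B₀ B₁ : ℝ} (ha : R < a) (hac : a ≤ c)
    (hcd : c ≤ d) (hL : 0 ≤ L) {h h' : ℝ → ℝ} (hh : ∀ r, HasDerivAt h (h' r) r)
    (hh' : Continuous h') (h0 : h c = 0) (h1 : h d = 0) (hB₀ : ∀ r ∈ Icc c d, |h r| ≤ B₀)
    (hB₁ : ∀ r ∈ Icc c d, |h' r| ≤ B₁) {s S : ℝ → ℝ} (hs : ContinuousOn s (Icc 0 L))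
    (hS : ContinuousOn S (Icc 0 L)) (hsΦ : ∀ u ∈ Icc 0 L, ∫ r in c..d, |Φ u r| ≤ s u)
    (hSΦ : ∀ u ∈ Icc 0 L, ∫ r in a..d, |Φ u r| ≤ S u) :
    |L * (∫ r in c..d, h r * Φ 0 r) -
        (∫ r in c..d, D' r / r * h r) / 2 * ∫ u in (0 : ℝ)..L, (L - u) * φ u a| ≤
      (B₀ + L * (K * B₁) / 2) * (∫ u in (0 : ℝ)..L, s u) +
        L / 2 * ((d - c) * (C / c ^ 3 * B₀)) * ∫ u in (0 : ℝ)..L, S u := by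
  have hc : R < c := ha.trans_le hac
  have hc0 : 0 < c := hD.R_pos.trans hc
  have hB₀0 : 0 ≤ B₀ := (abs_nonneg _).trans (hB₀ c ⟨le_rfl, hcd⟩)
  have hB₁0 : 0 ≤ B₁ := (abs_nonneg _).trans (hB₁ c ⟨le_rfl, hcd⟩)
  have hC := hD.C_pos
  have hK := hD.K_pos
  have hhc : Continuous h := continuous_iff_continuousAt.2 fun r => (hh r).continuousAt
  have hRa : Icc a d ⊆ Ioi R := fun s hs => ha.trans_le hs.1
  have hR : Icc c d ⊆ Ioi R := fun s hs => hc.trans_le hs.1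
  have hi : ∀ {g : ℝ → ℝ}, ContinuousOn g (Icc c d) → IntervalIntegrable g volume c d :=
    fun hg => ContinuousOn.intervalIntegrable (by rwa [uIcc_of_le hcd])
  have hiL : ∀ {g : ℝ → ℝ}, ContinuousOn g (Icc 0 L) → IntervalIntegrable g volume 0 L :=
    fun hg => ContinuousOn.intervalIntegrable (by rwa [uIcc_of_le hL])
  have hwD : ContinuousOn (fun r => D r * h' r) (Ioi R) := hD.continuousOn.mul hh'.continuousOn
  have hwD' : ContinuousOn (fun r => D' r / r * h r) (Ioi R) :=
    (hD.continuousOn_deriv.div continuousOn_id fun r hr => (hD.R_pos.trans hr).ne').mul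
      hhc.continuousOn
  have hbc : ContinuousOn (fun u => φ u a) (Ici 0) :=
    hw.continuousOn_field.comp (f := fun u : ℝ => (u, a)) (by fun_prop) fun u hu => ⟨hu, ha⟩
  have hg : ContinuousOn (Function.uncurry fun u r => φ u r - φ u a) (Ici 0 ×ˢ Ioi R) :=
    hw.continuousOn_field.sub (hbc.comp continuousOn_fst fun p hp => hp.1)
  set A := fun u => ∫ r in c..d, h r * Φ u r with hA
  set P := fun u => ∫ r in c..d, D r * h' r * Φ u r with hP
  set Q := fun u => ∫ r in c..d, D' r / r * h r * (φ u r - φ u a) with hQ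
  set κ := ∫ r in c..d, D' r / r * h r with hκ
  have hAc : ContinuousOn A (Ici 0) :=
    continuousOn_pairing hw.continuousOn_dr hhc.continuousOn hc hcd
  have hPc : ContinuousOn P (Ici 0) := continuousOn_pairing hw.continuousOn_dr hwD hc hcd
  have hQc : ContinuousOn Q (Ici 0) := continuousOn_pairing hg hwD' hc hcd
  -- Only `φ u r - φ u a` is controlled by `Φ`; the value at `r = a` is kept as an explicit term on
  -- the left of the estimate.
  have hsplit : ∀ u, 0 ≤ u → ∫ r in c..d, D' r / r * h r * φ u r = Q u + κ * φ u a := by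
    intro u hu
    have hgu : ContinuousOn (fun r => φ u r - φ u a) (Icc c d) :=
      (continuousOn_slice_right hg hu).mono hR
    refine Eq.trans ?_ ((intervalIntegral.integral_add (hi ((hwD'.mono hR).mul hgu))
      ((hi (hwD'.mono hR)).mul_const (φ u a))).trans
      (congrArg (_ + ·) (intervalIntegral.integral_mul_const _ _)))
    refine intervalIntegral.integral_congr fun r _ => ?_
    simp only [Pi.mul_apply]
    ring
  have hkey := integral_sub_mul_deriv (f := A)
    (f' := fun u => -(1 / 2) * (P u + (Q u + κ * φ u a))) hL hAc
    (continuousOn_const.mul (hPc.add (hQc.add (continuousOn_const.mul hbc)))) (fun u hu => by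
      have := hw.hasDerivAt_pairing hD hc hcd hu hh hh' h0 h1
      rwa [hsplit u hu.le] at this)
  have hsub : Icc 0 L ⊆ Ici (0 : ℝ) := Icc_subset_Ici_self
  have hLc : ContinuousOn (fun u : ℝ => L - u) (Icc 0 L) := by fun_prop
  have j1 := hiL (g := fun u => (L - u) * P u) (hLc.mul (hPc.mono hsub))
  have j2 := hiL (g := fun u => (L - u) * Q u) (hLc.mul (hQc.mono hsub))
  have j3 := hiL (g := fun u => (L - u) * φ u a) (hLc.mul (hbc.mono hsub))
  have hexp : ∫ u in (0 : ℝ)..L, (L - u) * (-(1 / 2) * (P u + (Q u + κ * φ u a))) =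
      -(1 / 2) * ((∫ u in (0 : ℝ)..L, (L - u) * P u) + ((∫ u in (0 : ℝ)..L, (L - u) * Q u) +
        κ * ∫ u in (0 : ℝ)..L, (L - u) * φ u a)) := by
    rw [← intervalIntegral.integral_const_mul κ, ← intervalIntegral.integral_add j2 (j3.const_mul κ),
      ← intervalIntegral.integral_add j1 (j2.add (j3.const_mul κ)),
      ← intervalIntegral.integral_const_mul]
    refine intervalIntegral.integral_congr fun u _ => ?_
    ring
  rw [hexp] at hkey
  have hpair : ∀ u ∈ Icc 0 L, ∀ {w : ℝ → ℝ} {B : ℝ}, (∀ r ∈ Icc c d, |w r| ≤ B) → 0 ≤ B →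
      |∫ r in c..d, w r * Φ u r| ≤ B * s u := by
    intro u hu w B hwB hB
    have hΦ : ContinuousOn (Φ u) (Icc c d) :=
      (continuousOn_slice_right hw.continuousOn_dr hu.1).mono hR
    refine le_trans (abs_integral_le_of_abs_le (g := fun r => B * |Φ u r|) hcd
      (fun r hr => ?_) (by fun_prop)) ?_
    · rw [abs_mul]
      exact mul_le_mul_of_nonneg_right (hwB r hr) (abs_nonneg _)
    · rw [intervalIntegral.integral_const_mul]
      exact mul_le_mul_of_nonneg_left (hsΦ u hu) hB
  have hAle : |∫ u in (0 : ℝ)..L, A u| ≤ B₀ * ∫ u in (0 : ℝ)..L, s u := by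
    rw [← intervalIntegral.integral_const_mul]
    refine abs_integral_le_of_abs_le hL (fun u hu => ?_) (continuousOn_const.mul hs)
    exact hpair u hu hB₀ hB₀0
  have hPle : |∫ u in (0 : ℝ)..L, (L - u) * P u| ≤ L * (K * B₁) * ∫ u in (0 : ℝ)..L, s u := by
    rw [← intervalIntegral.integral_const_mul]
    refine abs_integral_le_of_abs_le hL (fun u hu => ?_) (continuousOn_const.mul hs)
    have h2 : |P u| ≤ K * B₁ * s u := hpair u hu (fun r hr => by
      rw [abs_mul, abs_of_nonneg (hD.nonneg r (hR hr))]
      exact mul_le_mul (hD.le r (hR hr)) (hB₁ r hr) (abs_nonneg _) hK.le) (by positivity)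
    rw [abs_mul, abs_of_nonneg (by linarith [hu.2] : 0 ≤ L - u), mul_assoc]
    exact mul_le_mul (by linarith [hu.1]) h2 (abs_nonneg _) hL
  have hQle : |∫ u in (0 : ℝ)..L, (L - u) * Q u| ≤
      L * ((d - c) * (C / c ^ 3 * B₀)) * ∫ u in (0 : ℝ)..L, S u := by
    rw [← intervalIntegral.integral_const_mul]
    refine abs_integral_le_of_abs_le hL (fun u hu => ?_) (continuousOn_const.mul hS)
    have hΦ : ContinuousOn (Φ u) (Icc a d) :=
      (continuousOn_slice_right hw.continuousOn_dr hu.1).mono hRa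
    have h2 : |Q u| ≤ (d - c) * (C / c ^ 3 * B₀) * S u := by
      have hb : ∀ r ∈ uIoc c d, ‖D' r / r * h r * (φ u r - φ u a)‖ ≤ C / c ^ 3 * B₀ * S u := by
        intro r hr
        rw [uIoc_of_le hcd] at hr
        have hr' : r ∈ Icc c d := Ioc_subset_Icc_self hr
        have hr0 : 0 < r := hc0.trans_le hr'.1
        have har : a ≤ r := hac.trans hr'.1
        have e1 : |D' r / r| ≤ C / c ^ 3 := by
          rw [abs_div, abs_of_pos hr0]
          calc |D' r| / r ≤ C / r ^ 2 / r := by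
                gcongr
                exact hD.abs_deriv_le r (hR hr')
            _ = C / r ^ 3 := by field_simp
            _ ≤ C / c ^ 3 := by gcongr; exact hr'.1
        have e2 : |φ u r - φ u a| ≤ S u := by
          rw [hw.sub_eq_integral hu.1 ha har]
          refine (intervalIntegral.abs_integral_le_integral_abs har).trans
            (le_trans ?_ (hSΦ u hu))
          refine intervalIntegral.integral_mono_interval le_rfl har hr'.2
            (Eventually.of_forall fun s => abs_nonneg _) (ContinuousOn.intervalIntegrable ?_)
          rw [uIcc_of_le (har.trans hr'.2)]
          fun_prop
        rw [Real.norm_eq_abs, abs_mul, abs_mul]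
        gcongr
        exact hB₀ r hr'
      have := intervalIntegral.norm_integral_le_of_norm_le_const hb
      rw [abs_of_nonneg (by linarith : 0 ≤ d - c)] at this
      calc |Q u| ≤ C / c ^ 3 * B₀ * S u * (d - c) := this
        _ = _ := by ring
    rw [abs_mul, abs_of_nonneg (by linarith [hu.2] : 0 ≤ L - u), mul_assoc L]
    exact mul_le_mul (by linarith [hu.1]) h2 (abs_nonneg _) hL
  have hfin : L * A 0 - κ / 2 * ∫ u in (0 : ℝ)..L, (L - u) * φ u a =
      (∫ u in (0 : ℝ)..L, A u) + 1 / 2 * (∫ u in (0 : ℝ)..L, (L - u) * P u) +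
        1 / 2 * ∫ u in (0 : ℝ)..L, (L - u) * Q u := by
    linarith
  change |L * A 0 - _| ≤ _
  rw [hfin]
  rw [abs_le] at hAle hPle hQle ⊢
  constructor <;> nlinarith [hAle.1, hAle.2, hPle.1, hPle.2, hQle.1, hQle.2]

end Pairing

/-! ### Integrability of `r² Φ²` forces the Newman–Penrose constant to vanish. -/

theorem hasDerivAt_bump (c d r : ℝ) :
    HasDerivAt (fun r => (r - c) * (d - r)) (c + d - 2 * r) r :=
  (((hasDerivAt_id' r).sub_const c).mul ((hasDerivAt_id' r).const_sub d)).congr_deriv (by ring)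

theorem abs_bump_le {c d r : ℝ} (hr : r ∈ Icc c d) : |(r - c) * (d - r)| ≤ (d - c) ^ 2 := by
  obtain ⟨h1, h2⟩ := hr
  rw [abs_of_nonneg (mul_nonneg (by linarith) (by linarith)), sq]
  exact mul_le_mul (by linarith) (by linarith) (by linarith) (by linarith)

theorem abs_deriv_bump_le {c d r : ℝ} (hr : r ∈ Icc c d) : |c + d - 2 * r| ≤ d - c := by
  obtain ⟨h1, h2⟩ := hr
  rw [abs_le]; constructor <;> linarith

section Contradiction

variable {R K C : ℝ} {D D' : ℝ → ℝ} {φ Φ Φr : ℝ → ℝ → ℝ}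

theorem IsSphericalWave.integral_abs_le (hD : IsFlatCoefficient R K C D D')
    (hw : IsSphericalWave R D D' φ Φ Φr) {a c d b u δ : ℝ} (ha : R < a) (hac : a ≤ c)
    (hcd : c ≤ d) (hdb : d ≤ b) (hu : 0 ≤ u) (hδ : 0 < δ) :
    ∫ r in c..d, |Φ u r| ≤ δ⁻¹ * (∫ r in a..b, r ^ 2 * Φ u r ^ 2) + δ * a⁻¹ := by
  have ha0 : 0 < a := hD.R_pos.trans ha
  have hab : a ≤ b := hac.trans (hcd.trans hdb)
  have hΦ : ContinuousOn (Φ u) (Icc a b) :=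
    (continuousOn_slice_right hw.continuousOn_dr hu).mono fun s hs => ha.trans_le hs.1
  have h1 := integral_abs_le_young ha0 hab hδ hΦ
  have h2 : ∫ r in c..d, |Φ u r| ≤ ∫ r in a..b, |Φ u r| := by
    refine intervalIntegral.integral_mono_interval hac hcd hdb
      (Eventually.of_forall fun s => abs_nonneg _) (ContinuousOn.intervalIntegrable ?_)
    rw [uIcc_of_le hab]
    fun_prop
  have h3 : 0 ≤ δ * b⁻¹ := by have := ha0.trans_le hab; positivity
  linarith

theorem IsSphericalWave.continuousOn_energy (hw : IsSphericalWave R D D' φ Φ Φr) {c d : ℝ}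
    (hc : R < c) (hcd : c ≤ d) :
    ContinuousOn (fun u => ∫ r in c..d, r ^ 2 * Φ u r ^ 2) (Ici 0) := by
  refine continuousOn_intervalIntegral_param (f := fun u r => r ^ 2 * Φ u r ^ 2) hcd ?_
  have h1 : ContinuousOn (fun p : ℝ × ℝ => Φ p.1 p.2) (Ici 0 ×ˢ Icc c d) :=
    hw.continuousOn_dr.mono (prod_mono subset_rfl fun s hs => hc.trans_le hs.1)
  change ContinuousOn (fun p : ℝ × ℝ => p.2 ^ 2 * Φ p.1 p.2 ^ 2) _
  fun_prop

theorem IsSphericalWave.integral_young (hw : IsSphericalWave R D D' φ Φ Φr) {c d L : ℝ}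
    (hc : R < c) (hcd : c ≤ d) (hL : 0 ≤ L) (p q : ℝ) :
    ∫ u in (0 : ℝ)..L, (p * (∫ r in c..d, r ^ 2 * Φ u r ^ 2) + q) =
      p * (∫ u in (0 : ℝ)..L, ∫ r in c..d, r ^ 2 * Φ u r ^ 2) + q * L := by
  have hi : IntervalIntegrable (fun u => ∫ r in c..d, r ^ 2 * Φ u r ^ 2) volume 0 L :=
    ContinuousOn.intervalIntegrable (by
      rw [uIcc_of_le hL]; exact (hw.continuousOn_energy hc hcd).mono Icc_subset_Ici_self)
  rw [intervalIntegral.integral_add (hi.const_mul p) intervalIntegrable_const,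
    intervalIntegral.integral_const_mul, intervalIntegral.integral_const]
  simp [mul_comm]

/-- Near `r₁` the derivative `D'` keeps its sign, so the integrand does too. Multiplying by the
constant `D' r₁` treats both signs at once. -/
theorem exists_integral_bump_ne_zero (hD : IsFlatCoefficient R K C D D') {a r₁ : ℝ} (ha : R < a)
    (hr₁ : a < r₁) (h : D' r₁ ≠ 0) :
    ∃ c d, a ≤ c ∧ c < d ∧ ∫ r in c..d, D' r / r * ((r - c) * (d - r)) ≠ 0 := by
  have hcont : ContinuousAt (fun r => D' r * D' r₁) r₁ :=
    (hD.continuousOn_deriv.continuousAt (Ioi_mem_nhds (ha.trans hr₁))).mul continuousAt_const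
  have hpos : 0 < D' r₁ * D' r₁ := mul_self_pos.2 h
  have hev : ∀ᶠ r in 𝓝 r₁, 0 < D' r * D' r₁ ∧ a < r :=
    (hcont.eventually (lt_mem_nhds hpos)).and (Ioi_mem_nhds hr₁)
  obtain ⟨ε, hε, hball⟩ := Metric.nhds_basis_closedBall.mem_iff.1 hev
  have hIcc : ∀ r ∈ Icc (r₁ - ε) (r₁ + ε), 0 < D' r * D' r₁ ∧ a < r := fun r hr =>
    hball (by rw [Real.closedBall_eq_Icc]; exact hr)
  have hcd : r₁ - ε < r₁ + ε := by linarith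
  refine ⟨r₁ - ε, r₁ + ε, (hIcc _ ⟨le_rfl, hcd.le⟩).2.le, hcd, fun h0 => ?_⟩
  have hR : Icc (r₁ - ε) (r₁ + ε) ⊆ Ioi R := fun r hr => ha.trans (hIcc r hr).2
  have hD'r : ContinuousOn (fun r => D' r / r) (Icc (r₁ - ε) (r₁ + ε)) :=
    (hD.continuousOn_deriv.mono hR).div continuousOn_id
      fun r hr => (hD.R_pos.trans (hR hr)).ne'
  have hp : 0 < ∫ r in (r₁ - ε)..(r₁ + ε),
      D' r / r * ((r - (r₁ - ε)) * (r₁ + ε - r)) * D' r₁ := by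
    refine intervalIntegral.intervalIntegral_pos_of_pos_on (ContinuousOn.intervalIntegrable ?_)
      (fun r hr => ?_) hcd
    · rw [uIcc_of_le hcd.le]
      exact (hD'r.mul (by fun_prop)).mul continuousOn_const
    · have h1 := (hIcc r (Ioo_subset_Icc_self hr)).1
      have hr0 : 0 < r := hD.R_pos.trans (hR (Ioo_subset_Icc_self hr))
      have h2 : 0 < (r - (r₁ - ε)) * (r₁ + ε - r) :=
        mul_pos (by linarith [hr.1]) (by linarith [hr.2])
      have : D' r / r * ((r - (r₁ - ε)) * (r₁ + ε - r)) * D' r₁ =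
        D' r * D' r₁ * (((r - (r₁ - ε)) * (r₁ + ε - r)) / r) := by ring
      rw [this]
      positivity
  rw [intervalIntegral.integral_mul_const, h0, zero_mul] at hp
  exact lt_irrefl _ hp

/-- Integrability of `r² Φ²` controls the averages of the field on an `r = const` hypersurface. -/
theorem IsSphericalWave.exists_abs_integral_boundary_le (hD : IsFlatCoefficient R K C D D')
    (hw : IsSphericalWave R D D' φ Φ Φr) {a r₁ T : ℝ} (ha : R < a) (hr₁ : a < r₁)
    (h : D' r₁ ≠ 0)
    (hT : ∀ L, a ≤ L → ∫ u in (0 : ℝ)..L, ∫ r in a..(2 * L), r ^ 2 * Φ u r ^ 2 ≤ T) :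
    ∃ F₀ C₀ L₀ : ℝ, 0 ≤ C₀ ∧ ∀ L, L₀ ≤ L → ∀ δ, 0 < δ →
      |∫ u in (0 : ℝ)..L, (L - u) * φ u a| ≤ F₀ * L + C₀ * L * (δ⁻¹ * T + δ * a⁻¹ * L) := by
  obtain ⟨c, d, hac, hcd, hκ⟩ := exists_integral_bump_ne_zero hD ha hr₁ h
  set κ := ∫ r in c..d, D' r / r * ((r - c) * (d - r)) with hκdef
  have ha0 : 0 < a := hD.R_pos.trans ha
  have hc0 : 0 < c := ha0.trans_le hac
  have hC := hD.C_pos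
  have hK := hD.K_pos
  set A₀ := ∫ r in c..d, (r - c) * (d - r) * Φ 0 r with hA₀
  set C₁ := (d - c) ^ 2 + K * (d - c) / 2 + (d - c) * (C / c ^ 3 * (d - c) ^ 2) / 2 with hC₁
  have hdc : 0 < d - c := by linarith
  have hC₁0 : 0 ≤ C₁ := by positivity
  have hκ2 : 0 < |κ| / 2 := by positivity
  refine ⟨(|κ| / 2)⁻¹ * |A₀|, (|κ| / 2)⁻¹ * C₁, max (max a d) 1, by positivity,
    fun L hL δ hδ => ?_⟩
  have haL : a ≤ L := ((le_max_left _ _).trans (le_max_left _ _)).trans hL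
  have hdL : d ≤ L := ((le_max_right _ _).trans (le_max_left _ _)).trans hL
  have h1L : 1 ≤ L := (le_max_right _ _).trans hL
  have hL0 : 0 ≤ L := by linarith
  have ha2L : a ≤ 2 * L := by linarith
  set S := fun u => δ⁻¹ * (∫ r in a..(2 * L), r ^ 2 * Φ u r ^ 2) + δ * a⁻¹ with hS
  have hSc : ContinuousOn S (Icc 0 L) :=
    ((continuousOn_const.mul (hw.continuousOn_energy ha ha2L)).add continuousOn_const).mono
      Icc_subset_Ici_self
  have hSint : ∫ u in (0 : ℝ)..L, S u ≤ δ⁻¹ * T + δ * a⁻¹ * L := by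
    rw [hS, hw.integral_young ha ha2L hL0]
    gcongr
    exact hT L haL
  -- The bump is fixed while `L` grows, so the data term is `O(L)`, and `κ ≠ 0` permits solving for
  -- the boundary integral.
  have key := hw.abs_pairing_sub_le hD ha hac hcd.le hL0 (hasDerivAt_bump c d) (by fun_prop)
    (by ring) (by ring) (fun r => abs_bump_le) (fun r => abs_deriv_bump_le) hSc hSc
    (fun u hu => hw.integral_abs_le hD ha hac hcd.le (by linarith) hu.1 hδ)
    (fun u hu => hw.integral_abs_le hD ha le_rfl (hac.trans hcd.le) (by linarith) hu.1 hδ)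
  set X := ∫ u in (0 : ℝ)..L, (L - u) * φ u a with hX
  have hS0 : 0 ≤ ∫ u in (0 : ℝ)..L, S u := intervalIntegral.integral_nonneg hL0 fun u _ => by
    have : 0 ≤ ∫ r in a..(2 * L), r ^ 2 * Φ u r ^ 2 :=
      intervalIntegral.integral_nonneg ha2L fun r _ => by positivity
    positivity
  have hb : |κ| / 2 * |X| ≤ L * |A₀| + C₁ * L * ∫ u in (0 : ℝ)..L, S u := by
    have e1 : |κ / 2 * X| ≤ |L * A₀| + |L * A₀ - κ / 2 * X| := by
      have := abs_sub (L * A₀) (L * A₀ - κ / 2 * X)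
      rwa [sub_sub_cancel] at this
    rw [abs_mul, abs_mul, abs_div, abs_of_pos (two_pos : (0 : ℝ) < 2), abs_of_nonneg hL0] at e1
    have e2 : ((d - c) ^ 2 + L * (K * (d - c)) / 2) * (∫ u in (0 : ℝ)..L, S u) +
        L / 2 * ((d - c) * (C / c ^ 3 * (d - c) ^ 2)) * (∫ u in (0 : ℝ)..L, S u) ≤
        C₁ * L * ∫ u in (0 : ℝ)..L, S u := by
      rw [← add_mul]
      refine mul_le_mul_of_nonneg_right ?_ hS0
      have : (d - c) ^ 2 * 1 ≤ (d - c) ^ 2 * L := by gcongr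
      rw [hC₁]
      linarith
    linarith
  rw [← le_div_iff₀' hκ2] at hb
  refine hb.trans ?_
  rw [div_eq_inv_mul]
  have e3 : C₁ * L * ∫ u in (0 : ℝ)..L, S u ≤ C₁ * L * (δ⁻¹ * T + δ * a⁻¹ * L) := by gcongr
  calc (|κ| / 2)⁻¹ * (L * |A₀| + C₁ * L * ∫ u in (0 : ℝ)..L, S u)
      ≤ (|κ| / 2)⁻¹ * (L * |A₀| + C₁ * L * (δ⁻¹ * T + δ * a⁻¹ * L)) := by gcongr
    _ = _ := by ring

theorem integral_bump (L : ℝ) : ∫ r in L..(2 * L), (r - L) * (2 * L - r) = L ^ 3 / 6 := by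
  have h : ∀ r ∈ uIcc L (2 * L), HasDerivAt
      (fun r => 3 * L / 2 * r ^ 2 - r ^ 3 / 3 - 2 * L ^ 2 * r) ((r - L) * (2 * L - r)) r := by
    intro r _
    refine (((((hasDerivAt_id' r).pow 2).const_mul (3 * L / 2)).sub
      (((hasDerivAt_id' r).pow 3).div_const 3)).sub
      ((hasDerivAt_id' r).const_mul (2 * L ^ 2))).congr_deriv ?_
    push_cast
    ring
  rw [intervalIntegral.integral_eq_sub_of_hasDerivAt h
    (Continuous.intervalIntegrable (by fun_prop) _ _)]
  ring

/-- Lower bound for the pairing of the initial data with a bump at `r ~ L`. -/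
theorem le_abs_integral_bump {F : ℝ → ℝ} {I L : ℝ} (hL : 0 < L)
    (hF : ContinuousOn F (Icc L (2 * L))) (h : ∀ r, L ≤ r → I ^ 2 / 2 ≤ I * (r ^ 2 * F r)) :
    I ^ 2 * L / 48 ≤ |I| * |∫ r in L..(2 * L), (r - L) * (2 * L - r) * F r| := by
  have hL2 : L ≤ 2 * L := by linarith
  rw [← abs_mul]
  refine le_trans ?_ (le_abs_self _)
  rw [← intervalIntegral.integral_const_mul]
  have : I ^ 2 * L / 48 = ∫ r in L..(2 * L), I ^ 2 / (8 * L ^ 2) * ((r - L) * (2 * L - r)) := by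
    rw [intervalIntegral.integral_const_mul, integral_bump]
    field_simp
    ring
  rw [this]
  refine intervalIntegral.integral_mono_on hL2 (Continuous.intervalIntegrable (by fun_prop) _ _)
    (ContinuousOn.intervalIntegrable (by rw [uIcc_of_le hL2]; fun_prop)) fun r hr => ?_
  have hr0 : 0 < r := hL.trans_le hr.1
  have h1 := h r hr.1
  have h2 : 0 ≤ (r - L) * (2 * L - r) := mul_nonneg (by linarith [hr.1]) (by linarith [hr.2])
  have h3 : I ^ 2 / (8 * L ^ 2) ≤ I * F r := by
    have h4 : I ^ 2 / 2 / r ^ 2 ≤ I * F r := by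
      rw [div_le_iff₀ (by positivity)]; linarith
    refine le_trans ?_ h4
    rw [div_div]
    -- Uses `r ≤ 2 L`.
    have : 2 * r ^ 2 ≤ 8 * L ^ 2 := by nlinarith [hr.2]
    gcongr
  calc I ^ 2 / (8 * L ^ 2) * ((r - L) * (2 * L - r)) ≤ I * F r * ((r - L) * (2 * L - r)) := by
        gcongr
    _ = _ := by ring

/-- On an interval of length `L`, a coefficient of size `L⁻³` meets a bump of size `L²`. The bound
is uniform in `L`, so the boundary average need only be `o(L²)`. -/
theorem abs_integral_source_le (hD : IsFlatCoefficient R K C D D') {L : ℝ} (hL : R < L) :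
    |∫ r in L..(2 * L), D' r / r * ((r - L) * (2 * L - r))| ≤ C := by
  have hL0 : 0 < L := hD.R_pos.trans hL
  have hC := hD.C_pos
  have hL2 : L ≤ 2 * L := by linarith
  have := abs_integral_le_of_abs_le hL2 (f := fun r => D' r / r * ((r - L) * (2 * L - r)))
    (g := fun _ => C / L) (fun r hr => ?_) continuousOn_const
  · refine this.trans ?_
    rw [intervalIntegral.integral_const, smul_eq_mul]
    field_simp
    norm_num
  · have hr0 : 0 < r := hL0.trans_le hr.1
    have h1 := abs_bump_le hr
    rw [abs_mul, abs_div, abs_of_pos hr0]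
    calc |D' r| / r * |(r - L) * (2 * L - r)| ≤ C / L ^ 2 / L * (2 * L - L) ^ 2 := by
          gcongr
          · refine (hD.abs_deriv_le r (hL.trans_le hr.1)).trans ?_
            gcongr
            exact hr.1
          · exact hr.1
      _ = C / L := by field_simp; ring

/-- If `r² (∂_r φ)²` is integrable on `u ≥ 0`, `r ≥ a`, then the first Newman–Penrose constant
vanishes. -/
theorem IsSphericalWave.newmanPenrose_eq_zero (hD : IsFlatCoefficient R K C D D')
    (hw : IsSphericalWave R D D' φ Φ Φr) {a T I : ℝ} {ε : ℝ → ℝ} (ha : R < a)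
    (hT : ∀ L, a ≤ L → ∫ u in (0 : ℝ)..L, ∫ r in a..(2 * L), r ^ 2 * Φ u r ^ 2 ≤ T)
    (hε : ∀ L, a ≤ L → ∫ u in (0 : ℝ)..L, ∫ r in L..(2 * L), r ^ 2 * Φ u r ^ 2 ≤ ε L)
    (hε0 : Tendsto ε atTop (𝓝 0)) (hI : Tendsto (fun r => r ^ 2 * Φ 0 r) atTop (𝓝 I)) :
    I = 0 := by
  by_contra hI0
  have ha0 : 0 < a := hD.R_pos.trans ha
  have hC := hD.C_pos
  have hK := hD.K_pos
  have hIpos : 0 < |I| := abs_pos.2 hI0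
  obtain ⟨F₀, C₀, L₀, hC₀, hsource⟩ : ∃ F₀ C₀ L₀ : ℝ, 0 ≤ C₀ ∧ ∀ L, L₀ ≤ L → ∀ δ, 0 < δ →
      |(∫ r in L..(2 * L), D' r / r * ((r - L) * (2 * L - r))) / 2 *
        ∫ u in (0 : ℝ)..L, (L - u) * φ u a| ≤
      F₀ * L + C₀ * L * (δ⁻¹ * T + δ * a⁻¹ * L) := by
    -- The boundary average can be estimated only where `D'` is nonzero somewhere; otherwise its
    -- coefficient is zero.
    by_cases hz : ∀ r, a < r → D' r = 0
    · refine ⟨0, 0, a + 1, le_rfl, fun L hL δ hδ => ?_⟩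
      have : ∫ r in L..(2 * L), D' r / r * ((r - L) * (2 * L - r)) = 0 := by
        rw [intervalIntegral.integral_congr (g := fun _ => (0 : ℝ))]
        · simp
        · intro r hr
          rw [uIcc_of_le (by linarith)] at hr
          simp [hz r (by linarith [hr.1])]
      simp [this]
    · push Not at hz
      obtain ⟨r₁, hr₁, hne⟩ := hz
      obtain ⟨F₀, C₀, L₀, hC₀, h⟩ := hw.exists_abs_integral_boundary_le hD ha hr₁ hne hT
      refine ⟨C / 2 * F₀, C / 2 * C₀, max L₀ a, by positivity, fun L hL δ hδ => ?_⟩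
      have h1 := h L ((le_max_left _ _).trans hL) δ hδ
      have h2 := abs_integral_source_le hD (ha.trans_le ((le_max_right _ _).trans hL))
      rw [abs_mul, abs_div, abs_of_pos (two_pos : (0 : ℝ) < 2)]
      calc _ ≤ C / 2 * (F₀ * L + C₀ * L * (δ⁻¹ * T + δ * a⁻¹ * L)) := by gcongr
        _ = _ := by ring
  -- The tested identity divided by `L²`: the first bracket is `O(δ)` uniformly in `L`, the second
  -- tends to zero for fixed `δ`.
  have hmain : ∀ δ, 0 < δ → ∀ᶠ L in atTop, |I| / 48 ≤
      ((1 + K / 2) * δ + (C / 2 + C₀) * (δ * a⁻¹)) +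
        ((1 + K / 2) * δ⁻¹ * ε L + (F₀ + (C / 2 + C₀) * (δ⁻¹ * T)) * L⁻¹) := by
    intro δ hδ
    have hIlow : ∀ᶠ r in atTop, I ^ 2 / 2 ≤ I * (r ^ 2 * Φ 0 r) := by
      have hlim : Tendsto (fun r => I * (r ^ 2 * Φ 0 r)) atTop (𝓝 (I * I)) := hI.const_mul I
      have : I ^ 2 / 2 < I * I := by nlinarith [mul_self_pos.2 hI0]
      filter_upwards [hlim.eventually (lt_mem_nhds this)] with r hr using le_of_lt hr
    obtain ⟨L₁, hL₁⟩ := eventually_atTop.1 hIlow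
    filter_upwards [eventually_ge_atTop L₀, eventually_ge_atTop L₁, eventually_ge_atTop a]
      with L hL₀ hLL₁ haL
    have hL0 : 0 < L := ha0.trans_le haL
    have hL2 : L ≤ 2 * L := by linarith
    have ha2L : a ≤ 2 * L := by linarith
    have hRL : R < L := ha.trans_le haL
    have hlow := le_abs_integral_bump hL0 (F := Φ 0) (I := I)
      ((continuousOn_slice_right hw.continuousOn_dr (mem_Ici.2 le_rfl)).mono
        fun r hr => hRL.trans_le hr.1) fun r hr => hL₁ r (hLL₁.trans hr)
    set S := fun u => δ⁻¹ * (∫ r in a..(2 * L), r ^ 2 * Φ u r ^ 2) + δ * a⁻¹ with hS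
    -- Applying Young's inequality from `r = L` instead of `r = a` gives `δ L⁻¹`, which integrates
    -- over `0 ≤ u ≤ L` to just `δ`.
    set s := fun u => δ⁻¹ * (∫ r in L..(2 * L), r ^ 2 * Φ u r ^ 2) + δ * L⁻¹ with hs
    have hSc : ContinuousOn S (Icc 0 L) :=
      ((continuousOn_const.mul (hw.continuousOn_energy ha ha2L)).add continuousOn_const).mono
        Icc_subset_Ici_self
    have hsc : ContinuousOn s (Icc 0 L) :=
      ((continuousOn_const.mul (hw.continuousOn_energy hRL hL2)).add continuousOn_const).mono
        Icc_subset_Ici_self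
    have hSint : ∫ u in (0 : ℝ)..L, S u ≤ δ⁻¹ * T + δ * a⁻¹ * L := by
      rw [hS, hw.integral_young ha ha2L hL0.le]
      gcongr
      exact hT L haL
    have hsint : ∫ u in (0 : ℝ)..L, s u ≤ δ⁻¹ * ε L + δ := by
      rw [hs, hw.integral_young hRL hL2 hL0.le, mul_assoc δ, inv_mul_cancel₀ hL0.ne', mul_one]
      gcongr
      exact hε L haL
    have key := hw.abs_pairing_sub_le hD ha haL hL2 hL0.le (hasDerivAt_bump L (2 * L))
      (by fun_prop) (by ring) (by ring) (fun r => abs_bump_le) (fun r => abs_deriv_bump_le)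
      hsc hSc
      (fun u hu => hw.integral_abs_le hD hRL le_rfl hL2 le_rfl hu.1 hδ)
      (fun u hu => hw.integral_abs_le hD ha le_rfl ha2L le_rfl hu.1 hδ)
    have hsrc := hsource L hL₀ δ hδ
    set A₀ := ∫ r in L..(2 * L), (r - L) * (2 * L - r) * Φ 0 r with hA₀
    set Z := (∫ r in L..(2 * L), D' r / r * ((r - L) * (2 * L - r))) / 2 *
        ∫ u in (0 : ℝ)..L, (L - u) * φ u a with hZ
    have e1 : |L * A₀| ≤ |L * A₀ - Z| + |Z| := by
      have := abs_add_le (L * A₀ - Z) Z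
      rwa [sub_add_cancel] at this
    rw [abs_mul, abs_of_pos hL0] at e1
    have e2 : ((2 * L - L) ^ 2 + L * (K * (2 * L - L)) / 2) * (∫ u in (0 : ℝ)..L, s u) ≤
        L ^ 2 * ((1 + K / 2) * (δ⁻¹ * ε L + δ)) := by
      calc _ ≤ ((2 * L - L) ^ 2 + L * (K * (2 * L - L)) / 2) * (δ⁻¹ * ε L + δ) := by
            refine mul_le_mul_of_nonneg_left hsint ?_
            rw [show 2 * L - L = L by ring]
            positivity
        _ = _ := by ring
    have e3 : L / 2 * ((2 * L - L) * (C / L ^ 3 * (2 * L - L) ^ 2)) * (∫ u in (0 : ℝ)..L, S u) ≤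
        L ^ 2 * (C / 2 * (δ⁻¹ * T * L⁻¹ + δ * a⁻¹)) := by
      calc _ = L / 2 * C * (∫ u in (0 : ℝ)..L, S u) := by field_simp; ring
        _ ≤ L / 2 * C * (δ⁻¹ * T + δ * a⁻¹ * L) := by gcongr
        _ = _ := by field_simp
    have e4 : F₀ * L + C₀ * L * (δ⁻¹ * T + δ * a⁻¹ * L) =
        L ^ 2 * (F₀ * L⁻¹ + C₀ * (δ⁻¹ * T * L⁻¹ + δ * a⁻¹)) := by
      field_simp
    have e5 : |I| * L / 48 ≤ |A₀| := by
      have : |I| * (|I| * L / 48) ≤ |I| * |A₀| := by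
        calc |I| * (|I| * L / 48) = |I| ^ 2 * L / 48 := by ring
          _ = I ^ 2 * L / 48 := by rw [sq_abs]
          _ ≤ _ := hlow
      exact le_of_mul_le_mul_left this hIpos
    have e6 : L ^ 2 * (|I| / 48) ≤ L * |A₀| := by
      calc L ^ 2 * (|I| / 48) = L * (|I| * L / 48) := by ring
        _ ≤ _ := by gcongr
    refine le_of_mul_le_mul_left ?_ (by positivity : 0 < L ^ 2)
    calc L ^ 2 * (|I| / 48) ≤ L ^ 2 * ((1 + K / 2) * (δ⁻¹ * ε L + δ)) +
          L ^ 2 * (C / 2 * (δ⁻¹ * T * L⁻¹ + δ * a⁻¹)) +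
          L ^ 2 * (F₀ * L⁻¹ + C₀ * (δ⁻¹ * T * L⁻¹ + δ * a⁻¹)) := by linarith
      _ = _ := by ring
  have hle : ∀ δ, 0 < δ → |I| / 48 ≤ ((1 + K / 2) + (C / 2 + C₀) * a⁻¹) * δ := by
    intro δ hδ
    have hlim : Tendsto (fun L => ((1 + K / 2) * δ + (C / 2 + C₀) * (δ * a⁻¹)) +
        ((1 + K / 2) * δ⁻¹ * ε L + (F₀ + (C / 2 + C₀) * (δ⁻¹ * T)) * L⁻¹)) atTop
        (𝓝 (((1 + K / 2) * δ + (C / 2 + C₀) * (δ * a⁻¹)) +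
        ((1 + K / 2) * δ⁻¹ * 0 + (F₀ + (C / 2 + C₀) * (δ⁻¹ * T)) * 0))) :=
      tendsto_const_nhds.add ((hε0.const_mul _).add (tendsto_inv_atTop_zero.const_mul _))
    have := ge_of_tendsto hlim (hmain δ hδ)
    linarith
  set Q := (1 + K / 2) + (C / 2 + C₀) * a⁻¹ with hQ
  have hQ0 : 0 < Q := by positivity
  -- This choice would give `|I| / 48 ≤ |I| / 96`.
  have := hle (|I| / (96 * Q)) (by positivity)
  have h2 : Q * (|I| / (96 * Q)) = |I| / 96 := by field_simp
  linarith

end Contradiction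

/-! ### From interval integrals to the Lebesgue integral over the far region. -/

theorem ofReal_integral_Icc {f : ℝ → ℝ} {c d : ℝ} (hcd : c ≤ d) (hf : ContinuousOn f (Icc c d))
    (h0 : ∀ r, 0 ≤ f r) :
    ENNReal.ofReal (∫ r in c..d, f r) = ∫⁻ r in Icc c d, ENNReal.ofReal (f r) := by
  rw [intervalIntegral.integral_of_le hcd, ← integral_Icc_eq_integral_Ioc]
  exact ofReal_integral_eq_lintegral_ofReal (hf.integrableOn_compact isCompact_Icc)
    (Eventually.of_forall h0)

theorem ofReal_integral_Icc_prod_Icc {f : ℝ → ℝ → ℝ} {a b c d : ℝ} (hab : a ≤ b) (hcd : c ≤ d)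
    (hf : ContinuousOn (Function.uncurry f) (Icc a b ×ˢ Icc c d)) (h0 : ∀ u r, 0 ≤ f u r) :
    ENNReal.ofReal (∫ u in a..b, ∫ r in c..d, f u r) =
      ∫⁻ p in Icc a b ×ˢ Icc c d, ENNReal.ofReal (f p.1 p.2) := by
  have hi : IntegrableOn (Function.uncurry f) (Icc a b ×ˢ Icc c d) :=
    hf.integrableOn_compact (isCompact_Icc.prod isCompact_Icc)
  have h := setIntegral_prod (μ := volume) (ν := volume) _ hi
  rw [intervalIntegral.integral_of_le hab, ← integral_Icc_eq_integral_Ioc]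
  simp only [intervalIntegral.integral_of_le hcd, ← integral_Icc_eq_integral_Ioc]
  refine (congrArg ENNReal.ofReal h.symm).trans ?_
  exact ofReal_integral_eq_lintegral_ofReal hi (Eventually.of_forall fun p => h0 p.1 p.2)

section

variable {R K C : ℝ} {D D' : ℝ → ℝ} {φ Φ Φr : ℝ → ℝ → ℝ}

/-- The Newman–Penrose constant lives at `u = 0`, whereas integrability is assumed only for `u ≥
u₀`; this fills the gap. The energy bound is uniform in `u` and the outer radius, and `u` ranges
over a bounded set. -/
theorem IsSphericalWave.lintegral_strip_lt_top (hD : IsFlatCoefficient R K C D D')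
    (hw : IsSphericalWave R D D' φ Φ Φr) {a N : ℝ} (ha : R < a)
    (hN : ∀ r, a ≤ r → r ^ 2 * |Φ 0 r| ≤ N) (U : ℝ) :
    ∫⁻ p in Icc 0 U ×ˢ Ici a, ENNReal.ofReal (p.2 ^ 2 * Φ p.1 p.2 ^ 2) < ⊤ := by
  obtain ⟨A, hA⟩ := hw.exists_integral_le hD ha hN U
  have hslice : ∀ u ∈ Icc 0 U,
      ∫⁻ r in Ici a, ENNReal.ofReal (r ^ 2 * Φ u r ^ 2) ≤ ENNReal.ofReal A := by
    intro u hu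
    have hun : Ici a = ⋃ n : ℕ, Icc a (a + n) := by
      ext r
      simp only [mem_Ici, mem_iUnion, mem_Icc]
      refine ⟨fun hr => ?_, fun ⟨n, hn⟩ => hn.1⟩
      obtain ⟨n, hn⟩ := exists_nat_ge (r - a)
      exact ⟨n, hr, by linarith⟩
    have hdir : Directed (· ⊆ ·) fun n : ℕ => Icc a (a + n) :=
      Monotone.directed_le fun m n hmn => Icc_subset_Icc_right (by gcongr)
    rw [hun, setLIntegral_iUnion_of_directed _ hdir]
    refine iSup_le fun n => ?_
    have hn : a ≤ a + n := by linarith [n.cast_nonneg (α := ℝ)]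
    have hΦ : ContinuousOn (Φ u) (Icc a (a + n)) :=
      (continuousOn_slice_right hw.continuousOn_dr hu.1).mono fun s hs => ha.trans_le hs.1
    rw [← ofReal_integral_Icc hn (by fun_prop) fun r => by positivity]
    exact ENNReal.ofReal_le_ofReal (hA u hu _ hn)
  rw [Measure.volume_eq_prod, ← Measure.prod_restrict]
  refine (lintegral_prod_le _).trans_lt ?_
  calc ∫⁻ u in Icc 0 U, ∫⁻ r in Ici a, ENNReal.ofReal (r ^ 2 * Φ u r ^ 2)
      ≤ ∫⁻ _ in Icc 0 U, ENNReal.ofReal A := setLIntegral_mono' measurableSet_Icc hslice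
    _ < ⊤ := by
      rw [setLIntegral_const]
      exact ENNReal.mul_lt_top ENNReal.ofReal_lt_top (by simp)

theorem IsSphericalWave.lintegral_eq_top (hD : IsFlatCoefficient R K C D D')
    (hw : IsSphericalWave R D D' φ Φ Φr) {a I u₀ : ℝ} (ha : R < a)
    (hI : Tendsto (fun r => r ^ 2 * Φ 0 r) atTop (𝓝 I)) (hI0 : I ≠ 0) :
    ∫⁻ p in Ici u₀ ×ˢ Ici a, ENNReal.ofReal (p.2 ^ 2 * Φ p.1 p.2 ^ 2) = ⊤ := by
  by_contra hne
  refine hI0 ?_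
  have ha0 : 0 < a := hD.R_pos.trans ha
  obtain ⟨N, hN⟩ : ∃ N, ∀ r, a ≤ r → r ^ 2 * |Φ 0 r| ≤ N := by
    obtain ⟨L, hL⟩ := eventually_atTop.1
      (hI.abs.eventually (gt_mem_nhds (lt_add_one |I|)))
    have hΦ : ContinuousOn (fun r => r ^ 2 * Φ 0 r) (Icc a L) :=
      ContinuousOn.mul (by fun_prop)
        ((continuousOn_slice_right hw.continuousOn_dr (mem_Ici.2 le_rfl)).mono
          fun s hs => ha.trans_le hs.1)
    obtain ⟨B, hB⟩ := isCompact_Icc.exists_bound_of_continuousOn hΦ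
    refine ⟨max B (|I| + 1), fun r hr => ?_⟩
    have habs : r ^ 2 * |Φ 0 r| = |r ^ 2 * Φ 0 r| := by
      rw [abs_mul, abs_of_nonneg (sq_nonneg r)]
    rw [habs]
    rcases le_total r L with h | h
    · exact (hB r ⟨hr, h⟩).trans (le_max_left _ _)
    · exact (hL r h).le.trans (le_max_right _ _)
  -- As a measure, the energy gives the vanishing of the tails `r ≥ L` by continuity from above.
  set ν : Measure (ℝ × ℝ) := volume.withDensity
    fun p => ENNReal.ofReal (p.2 ^ 2 * Φ p.1 p.2 ^ 2) with hν
  have hνs : ∀ {s t : Set ℝ}, MeasurableSet s → MeasurableSet t →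
      ν (s ×ˢ t) = ∫⁻ p in s ×ˢ t, ENNReal.ofReal (p.2 ^ 2 * Φ p.1 p.2 ^ 2) :=
    fun hs ht => withDensity_apply _ (hs.prod ht)
  have hfin : ν (Ici 0 ×ˢ Ici a) ≠ ⊤ := by
    have hsub : Ici (0 : ℝ) ×ˢ Ici a ⊆ Icc 0 u₀ ×ˢ Ici a ∪ Ici u₀ ×ˢ Ici a := by
      rintro ⟨u, r⟩ ⟨hu, hr⟩
      rcases le_total u u₀ with h | h
      · exact Or.inl ⟨⟨hu, h⟩, hr⟩
      · exact Or.inr ⟨h, hr⟩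
    refine ((measure_mono hsub).trans (measure_union_le _ _)).trans_lt ?_ |>.ne
    rw [hνs measurableSet_Icc measurableSet_Ici, hνs measurableSet_Ici measurableSet_Ici]
    exact ENNReal.add_lt_top.2 ⟨hw.lintegral_strip_lt_top hD ha hN u₀, lt_top_iff_ne_top.2 hne⟩
  have hrect : ∀ L c, a ≤ c → c ≤ 2 * L → 0 ≤ L →
      ∫ u in (0 : ℝ)..L, ∫ r in c..(2 * L), r ^ 2 * Φ u r ^ 2 ≤ (ν (Ici 0 ×ˢ Ici c)).toReal := by
    intro L c hac hc hL
    have hle : ν (Ici 0 ×ˢ Ici c) ≤ ν (Ici 0 ×ˢ Ici a) :=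
      measure_mono (prod_mono subset_rfl (Ici_subset_Ici.2 hac))
    have hcont : ContinuousOn (fun p : ℝ × ℝ => Φ p.1 p.2) (Icc 0 L ×ˢ Icc c (2 * L)) :=
      hw.continuousOn_dr.mono
        (prod_mono Icc_subset_Ici_self fun s hs => ha.trans_le (hac.trans hs.1))
    have h := ofReal_integral_Icc_prod_Icc (f := fun u r => r ^ 2 * Φ u r ^ 2) hL hc
      (by
        change ContinuousOn (fun p : ℝ × ℝ => p.2 ^ 2 * Φ p.1 p.2 ^ 2) _
        fun_prop)
      fun u r => by positivity
    rw [← hνs measurableSet_Icc measurableSet_Icc] at h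
    rw [← ENNReal.ofReal_le_iff_le_toReal (ne_top_of_le_ne_top hfin hle), h]
    exact measure_mono (prod_mono Icc_subset_Ici_self Icc_subset_Ici_self)
  refine hw.newmanPenrose_eq_zero hD ha (T := (ν (Ici 0 ×ˢ Ici a)).toReal)
    (ε := fun L => (ν (Ici 0 ×ˢ Ici L)).toReal)
    (fun L hL => hrect L a le_rfl (by linarith) (by linarith))
    (fun L hL => hrect L L hL (by linarith) (by linarith)) ?_ hI
  have hanti : Antitone fun L : ℝ => Ici (0 : ℝ) ×ˢ Ici L := fun L L' h =>
    prod_mono subset_rfl (Ici_subset_Ici.2 h)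
  have hlim := tendsto_measure_iInter_atTop (μ := ν)
    (fun L : ℝ => (measurableSet_Ici.prod measurableSet_Ici).nullMeasurableSet) hanti ⟨a, hfin⟩
  have hempty : ⋂ L : ℝ, Ici (0 : ℝ) ×ˢ Ici L = ∅ := by
    refine eq_empty_of_forall_notMem fun p hp => ?_
    have := (mem_iInter.1 hp (p.2 + 1)).2
    simp only [mem_Ici] at this
    linarith
  rw [hempty, measure_empty] at hlim
  exact (ENNReal.tendsto_toReal ENNReal.zero_ne_top).comp hlim

end

/-! ### Conclusion. -/

theorem IsAsymptoticallyFlat.exists_isFlatCoefficient {R M β : ℝ} {D : ℝ → ℝ}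
    (hD : IsAsymptoticallyFlat R M β D) : ∃ K C, IsFlatCoefficient R K C D (deriv D) := by
  obtain ⟨K, hK, hDK⟩ := hD.exists_abs_le
  obtain ⟨C, hC, hDC⟩ := hD.exists_abs_deriv_le
  exact ⟨K, C, hD.R_pos, hK, hC, fun r hr => hD.hasDerivAt hr, hD.continuousOn_deriv,
    fun r hr => (hD.pos r hr.le).le, fun r hr => (le_abs_self _).trans (hDK r hr), hDC⟩

end BondiWave

end

theorem proposition6p1 (R M β : ℝ) (D : ℝ → ℝ)
    (hD : BondiWave.IsAsymptoticallyFlat R M β D)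
    (ψ : ℝ × EuclideanSpace ℝ (Fin 3) → ℝ)
    (hψ : BondiWave.IsLinearWave D R ψ)
    (I₀ : ℝ) (hI : BondiWave.HasNewmanPenroseConstant ψ I₀) (hI₀ : I₀ ≠ 0)
    (u₀ : ℝ) (hu₀ : 0 ≤ u₀) :
    ∫⁻ p in (Ici u₀ ×ˢ Ici R : Set (ℝ × ℝ)),
      ENNReal.ofReal (p.2 ^ 2 * (BondiWave.drRadiationField ψ p.1 p.2) ^ 2) = ⊤ := by
  obtain ⟨K, C, hDf⟩ := hD.exists_isFlatCoefficient
  obtain ⟨φ, Φr, Φ, hw, hΦ⟩ := hψ.isSphericalWave hD.R_pos fun r hr => hD.hasDerivAt hr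
  -- The reduced equation is available only for `r > R`; since the integrand is nonnegative,
  -- divergence over `r ≥ R + 1` suffices.
  have ha : R < R + 1 := lt_add_one R
  have hlim : Tendsto (fun r => r ^ 2 * Φ 0 r) atTop (𝓝 I₀) := by
    refine hI.congr' ?_
    filter_upwards [eventually_gt_atTop R] with r hr
    rw [hΦ 0 r le_rfl hr]
  rw [eq_top_iff, ← hw.lintegral_eq_top hDf (u₀ := u₀) ha hlim hI₀]
  calc ∫⁻ p in Ici u₀ ×ˢ Ici (R + 1), ENNReal.ofReal (p.2 ^ 2 * Φ p.1 p.2 ^ 2)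
      = ∫⁻ p in Ici u₀ ×ˢ Ici (R + 1),
          ENNReal.ofReal (p.2 ^ 2 * (BondiWave.drRadiationField ψ p.1 p.2) ^ 2) := by
        refine setLIntegral_congr_fun (measurableSet_Ici.prod measurableSet_Ici) fun p hp => ?_
        simp only [hΦ p.1 p.2 (hu₀.trans hp.1) (ha.trans_le hp.2)]
    _ ≤ _ := lintegral_mono_set (prod_mono subset_rfl (Ici_subset_Ici.2 ha.le))
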